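/- Lemma 2.2. Let $G=(V,E)$ be a finite simple graph with $V=[n]$, and let $P_G\in(\mathbb{R}\cup\{\bot\})^{n\times n}$ be the partial matrix with $P_G(i,j)=1$ if $i=j$, $P_G(i,j)=0$ if $\{i,j\}\in E$, and $P_G(i,j)=\bot$ otherwise; let $\Omega=\{(i,j): P_G(i,j)\neq\bot\}$ be the set of revealed entries. Let $M\in\mathbb{R}^{n\times n}$ be a matrix of rank $r$ and let $c,\epsilon$ be real numbers with $cr\ge 1$ such that \[|M(i,j)|\le c\ \text{ for all } i,j\in[n],\qquad \sum_{(i,j)\in\Omega}\bigl(M(i,j)-P_G(i,j)\bigr)^2\le \epsilon n.\] Then $G$ has an independent set $T$ of size \[|T|\ \ge\ \frac{\bigl(1-4(cr)^2\epsilon\bigr)\,n}{r\sqrt{\pi}\,\bigl(8\sqrt{cr}\bigr)^r}.\] Moreover, there is a randomized polynomial time algorithm for finding such an independent set: there is a single randomized algorithm which, given $G$ and a matrix $M$ with rational entries (in binary), halts on every input and for all outcomes of its coin flips within time polynomial in the bit length of $(G,M)$, and which, whenever $M$ has rank $r$ and satisfies the two conditions above for some $c,\epsilon$ with $cr\ge1$,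 outputs with probability at least $2/3$ an independent set of $G$ whose size is at least the stated bound (for all such $c,\epsilon$). -/

import Mathlib

/-! ## The partial matrix of a graph -/

/-- The partial matrix `P_G` with entries in `ℝ ∪ {⊥}` (`⊥` is `none`): ones on the diagonal,
zeros at the edges, everything else unrevealed. -/
noncomputable def partialMatrix {n : ℕ} (G : SimpleGraph (Fin n)) :
    Matrix (Fin n) (Fin n) (Option ℝ) :=
  open Classical in
  Matrix.of fun i j => if i = j then some 1 else if G.Adj i j then some 0 else none

/-- The set `Ω` of revealed entries of a partial matrix. -/
def revealed {n : ℕ} (P : Matrix (Fin n) (Fin n) (Option ℝ)) : Finset (Fin n × Fin n) :=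
  Finset.univ.filter fun q => (P q.1 q.2).isSome

/-- The squared error of `M` on the revealed entries of `P`
(the default value in `getD` is never used, since the sum runs over revealed entries only). -/
noncomputable def revealedError {n : ℕ} (P : Matrix (Fin n) (Fin n) (Option ℝ))
    (M : Matrix (Fin n) (Fin n) ℝ) : ℝ :=
  ∑ q ∈ revealed P, (M q.1 q.2 - (P q.1 q.2).getD 0) ^ 2

/-- `M` is a rank `r` matrix with entries bounded by `c` in absolute value and with squared error
at most `ε n` on the revealed entries of `P_G`. -/
structure IsApproxCompletion {n : ℕ} (G : SimpleGraph (Fin n)) (M : Matrix (Fin n) (Fin n) ℝ)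
    (r : ℕ) (c ε : ℝ) : Prop where
  rank_eq : M.rank = r
  abs_le : ∀ i j, |M i j| ≤ c
  error_le : revealedError (partialMatrix G) M ≤ ε * n

/-- The guaranteed size of the independent set. -/
noncomputable def indepBound (n r : ℕ) (c ε : ℝ) : ℝ :=
  (1 - 4 * (c * r) ^ 2 * ε) * n / (r * √Real.pi * (8 * √(c * r)) ^ r)

/-! ## Random access machines with logarithmic cost

Structured programs over integer variables and integer arrays. Every operation is charged the
number of bits of the integers it handles, so that running times agree with those of Turing
machines up to a polynomial. -/

namespace LogRAM

/-- A memory: integer variables, named by natural numbers, and integer arrays,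
named by natural numbers and indexed by integers. -/
structure State where
  var : ℕ → ℤ
  arr : ℕ → ℤ → ℤ

/-- Arithmetic expressions. -/
inductive Expr
  | const (z : ℤ)
  | var (x : ℕ)
  | get (a : ℕ) (i : Expr)
  | add (e f : Expr)
  | sub (e f : Expr)
  | mul (e f : Expr)
  | div (e f : Expr)

/-- The value of an expression (`div` is integer division, with value `0` for divisor `0`). -/
def Expr.eval (s : State) : Expr → ℤ
  | .const z => z
  | .var x => s.var x
  | .get a i => s.arr a (i.eval s)
  | .add e f => e.eval s + f.eval s
  | .sub e f => e.eval s - f.eval s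
  | .mul e f => e.eval s * f.eval s
  | .div e f => e.eval s / f.eval s

/-- The bit length of an integer, with one extra bit for the sign. -/
def bits (z : ℤ) : ℕ := z.natAbs.size + 1

/-- The cost of evaluating an expression: the total bit length of the values of all its
subexpressions, array indices included. -/
def Expr.cost (s : State) : Expr → ℕ
  | .const z => bits z
  | .var x => bits (s.var x)
  | .get a i => i.cost s + bits (s.arr a (i.eval s))
  | .add e f => e.cost s + f.cost s + bits (e.eval s + f.eval s)
  | .sub e f => e.cost s + f.cost s + bits (e.eval s - f.eval s)
  | .mul e f => e.cost s + f.cost s + bits (e.eval s * f.eval s)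
  | .div e f => e.cost s + f.cost s + bits (e.eval s / f.eval s)

/-- Programs. A guard `e` of a conditional or of a loop is true when its value is positive. -/
inductive Prog
  | skip
  | assign (x : ℕ) (e : Expr)
  | put (a : ℕ) (i e : Expr)
  | seq (p q : Prog)
  | ite (e : Expr) (p q : Prog)
  | while (e : Expr) (p : Prog)

/-- Assign the value `z` to the variable `x`. -/
def State.setVar (s : State) (x : ℕ) (z : ℤ) : State :=
  { s with var := Function.update s.var x z }

/-- Write the value `z` into the array `a` at index `i`. -/
def State.setArr (s : State) (a : ℕ) (i z : ℤ) : State :=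
  { s with arr := Function.update s.arr a (Function.update (s.arr a) i z) }

/-- `Exec p s s₁ t`: the program `p`, started in the memory `s`, halts in the memory `s₁` after
a computation of cost `t`. -/
inductive Exec : Prog → State → State → ℕ → Prop
  | skip (s : State) : Exec .skip s s 1
  | assign (x : ℕ) (e : Expr) (s : State) :
      Exec (.assign x e) s (s.setVar x (e.eval s)) (e.cost s + 1)
  | put (a : ℕ) (i e : Expr) (s : State) :
      Exec (.put a i e) s (s.setArr a (i.eval s) (e.eval s)) (i.cost s + e.cost s + 1)
  | seq {p q : Prog} {s s₁ s₂ : State} {t₁ t₂ : ℕ} :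
      Exec p s s₁ t₁ → Exec q s₁ s₂ t₂ → Exec (.seq p q) s s₂ (t₁ + t₂)
  | ite_true {e : Expr} {p q : Prog} {s s₁ : State} {t : ℕ} :
      0 < e.eval s → Exec p s s₁ t → Exec (.ite e p q) s s₁ (e.cost s + t + 1)
  | ite_false {e : Expr} {p q : Prog} {s s₁ : State} {t : ℕ} :
      e.eval s ≤ 0 → Exec q s s₁ t → Exec (.ite e p q) s s₁ (e.cost s + t + 1)
  | while_true {e : Expr} {p : Prog} {s s₁ s₂ : State} {t₁ t₂ : ℕ} :
      0 < e.eval s → Exec p s s₁ t₁ → Exec (.while e p) s₁ s₂ t₂ →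
      Exec (.while e p) s s₂ (e.cost s + t₁ + t₂ + 1)
  | while_false {e : Expr} {p : Prog} {s : State} :
      e.eval s ≤ 0 → Exec (.while e p) s s (e.cost s + 1)

/-- The probability of the event `S` under `k` independent fair coin flips. -/
noncomputable def coinProb (k : ℕ) (S : Set (Fin k → Bool)) : ℝ := (S.ncard : ℝ) / 2 ^ k

/-- A randomized polynomial time algorithm for a search problem. Instances `x` have the bit size
`size x`, and `load x w` is the initial memory that holds the instance `x` and a string `w` of
random bits; `Sol x s` says that the final memory `s` holds a solution of `x`. A single program
has to halt on every instance `x` and for all coin flips within time `p (size x)`, using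
`p (size x)` coin flips for a fixed polynomial `p`, and on every instance in `Valid` it has to
find a solution with probability at least `2 / 3`. -/
def RandPolyTimeSolvable {X : Type} (size : X → ℕ)
    (load : X → (k : ℕ) → (Fin k → Bool) → State)
    (Valid : X → Prop) (Sol : X → State → Prop) : Prop :=
  ∃ (prog : Prog) (p : Polynomial ℕ), ∀ x : X,
    (∀ w : Fin (p.eval (size x)) → Bool, ∃ (s : State) (t : ℕ),
      Exec prog (load x _ w) s t ∧ t ≤ p.eval (size x)) ∧
    (Valid x → 2 / 3 ≤ coinProb (p.eval (size x))
      {w | ∃ (s : State) (t : ℕ), Exec prog (load x _ w) s t ∧ Sol x s})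

end LogRAM

/-! ## The computational problem -/

/-- An input of the algorithm: a graph on `n` vertices and a rational `n × n` matrix. -/
structure GraphMatrixInput where
  n : ℕ
  G : SimpleGraph (Fin n)
  M : Matrix (Fin n) (Fin n) ℚ

namespace GraphMatrixInput

/-- The real matrix of an input. -/
def realM (x : GraphMatrixInput) : Matrix (Fin x.n) (Fin x.n) ℝ := x.M.map fun q => (q : ℝ)

/-- The bit size of an input: one bit for each entry of the adjacency matrix, and numerator and
denominator in binary for each entry of the matrix. -/
def size (x : GraphMatrixInput) : ℕ :=
  ∑ i, ∑ j, (1 + LogRAM.bits (x.M i j).num + LogRAM.bits ((x.M i j).den : ℤ))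

/-- The array that stores an `n × n` matrix row by row: entry `(i, j)` at index `i * n + j`,
and zeros elsewhere. -/
def flatten {n : ℕ} (A : Fin n → Fin n → ℤ) (z : ℤ) : ℤ :=
  ∑ i : Fin n, ∑ j : Fin n, if z = (i : ℤ) * n + j then A i j else 0

/-- The initial memory: variable `0` holds `n`, array `0` holds the adjacency matrix, the arrays
`1` and `2` hold the numerators and denominators of the matrix entries, and array `3` holds the
random bits. All other variables and array entries are zero. -/
noncomputable def load (x : GraphMatrixInput) (k : ℕ) (w : Fin k → Bool) : LogRAM.State :=
  open Classical in
  { var := fun v => if v = 0 then (x.n : ℤ) else 0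
    arr := fun a z => match a with
      | 0 => flatten (fun i j => if x.G.Adj i j then 1 else 0) z
      | 1 => flatten (fun i j => (x.M i j).num) z
      | 2 => flatten (fun i j => ((x.M i j).den : ℤ)) z
      | 3 => ∑ l : Fin k, if z = (l : ℤ) ∧ w l = true then 1 else 0
      | _ => 0 }

/-- The set of vertices that a memory holds as output: those `i` with entry `1` at index `i` of
array `4`. -/
def output (x : GraphMatrixInput) (s : LogRAM.State) : Finset (Fin x.n) :=
  Finset.univ.filter fun i => s.arr 4 (i : ℤ) = 1

end GraphMatrixInput

/-! ## Clustering the vertices along a low rank factorization -/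

/-! Existence. A row of error at least 1/4 uses up 1/4 of the total error, so at most `4 ε n` rows
are bad (`le_card_goodSet`). If good vertices `i`, `j` were adjacent, then `M i i` and `M j j` would
be near 1, `M i j` and `M j i` near 0, and `M i i + M j j - M i j - M j i` would exceed 0.58. For a
factorization `M i j = ∑ q, a i q * b j q` this quantity equals `∑ q, (a i q - a j q) * (b i q - b j
q)`, and `x * y ≤ (μ * x + y)² / (4 * μ)` bounds it through the numbers `μ * a i q + b i q` alone.
Rounding these `r` numbers to a grid therefore makes every class of good vertices in a common cell
independent (`isIndepSet_cellClass`). With at most `2 * m + 1` values per coordinate, some class has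
at least `|good| / (2 * m + 1) ^ r` members (`card_le_of_card_cellClass_le`). Using one number per
coordinate, rather than both `a` and `b`, keeps the exponent at `r`.

The grid is short because the factorization is balanced. Take a row basis of `M`, completed by unit
vectors, of maximal determinant: by Cramer's rule all coordinates satisfy `|a| ≤ 1`, while `|b| ≤ c`
since `b` consists of entries of `M` (`exists_maximal_basis`, `eq_sum_rowPositions`).

Algorithm. Clear denominators and reach an approximately maximal basis, `|a| ≤ 3/2`, by
fraction-free pivoting over the integers. Tableau entries are determinants (`tableau_apply`), so
they stay of polynomial length, and each exchange of one matrix row for another at least doubles the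
squared determinant, so there are polynomially many pivots (`pivotMeasure_update_lt`). Then round,
group, and output a largest class. The largest absolute value of an entry of `M` replaces `c`, so
one output serves all admissible `c` and `ε`. The program never reads its random bits and always
succeeds.

The machine part bounds every stored integer by one number `H`; running time is then the number of
steps times the bit length of `H` (`Run`). -/

/-- The squared error of `M` on the revealed entries of row `i` of `P_G`. -/
noncomputable def rowError {n : ℕ} (G : SimpleGraph (Fin n)) (M : Matrix (Fin n) (Fin n) ℝ)
    (i : Fin n) : ℝ :=
  open Classical in
  ∑ j, ((if i = j then 1 else 0) + if G.Adj i j then 1 else 0) *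
    (M i j - if i = j then 1 else 0) ^ 2

theorem revealedError_eq_sum_rowError {n : ℕ} (G : SimpleGraph (Fin n))
    (M : Matrix (Fin n) (Fin n) ℝ) :
    revealedError (partialMatrix G) M = ∑ i, rowError G M i := by
  classical
  unfold revealedError revealed rowError
  rw [Finset.sum_filter, ← Finset.univ_product_univ, Finset.sum_product]
  refine Finset.sum_congr rfl fun i _ => Finset.sum_congr rfl fun j _ => ?_
  by_cases hij : i = j
  · subst hij
    simp [partialMatrix]
  · by_cases ha : G.Adj i j <;> simp [partialMatrix, hij, ha]

theorem rowError_term_nonneg {n : ℕ} (G : SimpleGraph (Fin n)) (M : Matrix (Fin n) (Fin n) ℝ)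
    (i j : Fin n) : open Classical in
    0 ≤ ((if i = j then (1 : ℝ) else 0) + if G.Adj i j then 1 else 0) *
      (M i j - if i = j then 1 else 0) ^ 2 := by
  classical
  refine mul_nonneg (add_nonneg ?_ ?_) (sq_nonneg _) <;> split_ifs <;> norm_num

theorem rowError_nonneg {n : ℕ} (G : SimpleGraph (Fin n)) (M : Matrix (Fin n) (Fin n) ℝ)
    (i : Fin n) : 0 ≤ rowError G M i :=
  Finset.sum_nonneg fun j _ => rowError_term_nonneg G M i j

theorem sq_add_sq_le_rowError {n : ℕ} {G : SimpleGraph (Fin n)} {M : Matrix (Fin n) (Fin n) ℝ}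
    {i j : Fin n} (h : G.Adj i j) : (M i i - 1) ^ 2 + M i j ^ 2 ≤ rowError G M i := by
  classical
  have hij : i ≠ j := h.ne
  have := Finset.sum_le_sum_of_subset_of_nonneg (Finset.subset_univ {i, j})
    (fun k _ _ => rowError_term_nonneg G M i k)
  rw [Finset.sum_pair hij] at this
  simpa [hij, h, rowError] using this

/-- The vertices whose row of `M` is close to the revealed entries of `P_G`. -/
noncomputable def goodSet {n : ℕ} (G : SimpleGraph (Fin n)) (M : Matrix (Fin n) (Fin n) ℝ) :
    Finset (Fin n) :=
  open Classical in Finset.univ.filter fun i => rowError G M i < 1 / 4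

/-- Markov's inequality gives at most `4 ε n` bad rows; the factor `(c * r) ^ 2 ≥ 1` only weakens
this, because `ε * n` is nonnegative. -/
theorem le_card_goodSet {n r : ℕ} {c ε : ℝ} {G : SimpleGraph (Fin n)}
    {M : Matrix (Fin n) (Fin n) ℝ} (hcr : 1 ≤ c * r) (h : IsApproxCompletion G M r c ε) :
    (1 - 4 * (c * r) ^ 2 * ε) * n ≤ ((goodSet G M).card : ℝ) := by
  classical
  have herr := h.error_le
  rw [revealedError_eq_sum_rowError] at herr
  have hεn : 0 ≤ ε * n := le_trans (Finset.sum_nonneg fun i _ => rowError_nonneg G M i) herr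
  have hbad : (((Finset.univ.filter fun i => ¬ rowError G M i < 1 / 4).card : ℕ) : ℝ) * (1 / 4)
      ≤ ε * n := by
    refine le_trans ?_ herr
    rw [← nsmul_eq_mul, ← Finset.sum_const]
    refine le_trans (Finset.sum_le_sum fun i hi => ?_)
      (Finset.sum_le_sum_of_subset_of_nonneg (Finset.filter_subset _ _)
        fun i _ _ => rowError_nonneg G M i)
    simpa using (Finset.mem_filter.1 hi).2
  have hcard := Finset.card_filter_add_card_filter_not (s := (Finset.univ : Finset (Fin n)))
    (fun i => rowError G M i < 1 / 4)
  have hcard' : ((goodSet G M).card : ℝ) +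
      ((Finset.univ.filter fun i => ¬ rowError G M i < 1 / 4).card : ℝ) = n := by
    unfold goodSet
    exact_mod_cast hcard.trans (by simp)
  have hsq : 1 ≤ (c * r) ^ 2 := one_le_pow₀ hcr
  nlinarith

/-- The members of `S` that share all the cells in `K` with `k`. -/
def cellClass {n : ℕ} (S K : Finset (Fin n)) (cell : Fin n → Fin n → ℤ) (k : Fin n) :
    Finset (Fin n) :=
  S.filter fun i => ∀ q ∈ K, cell i q = cell k q

/-- Common to the existence proof and the algorithm, hence stated for any factorization and any cell
function. An edge inside a class forces `M i i + M j j - M i j - M j i` above 0.58, whereas the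
common cell forces it below 25/48. -/
theorem isIndepSet_cellClass {n : ℕ} {G : SimpleGraph (Fin n)} {M : Matrix (Fin n) (Fin n) ℝ}
    {K : Finset (Fin n)} {a b : Fin n → Fin n → ℝ} {cell : Fin n → Fin n → ℤ} {μ h : ℝ}
    (hM : ∀ i j, M i j = ∑ q ∈ K, a i q * b j q) (hμ : 0 < μ)
    (hcell : ∀ i j, ∀ q ∈ K, cell i q = cell j q →
      |(μ * a i q + b i q) - (μ * a j q + b j q)| ≤ h)
    (hh : K.card * h ^ 2 ≤ 25 / 12 * μ) (k : Fin n) :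
    G.IsIndepSet (cellClass (goodSet G M) K cell k : Set (Fin n)) := by
  classical
  intro i hi j hj hij hadj
  simp only [cellClass, goodSet, Finset.coe_filter, Finset.mem_filter, Finset.mem_univ, true_and,
    Set.mem_ofPred_eq] at hi hj
  have hq : M i i + M j j - M i j - M j i ≤ 25 / 48 := by
    have h1 : M i i + M j j - M i j - M j i
        = ∑ q ∈ K, (a i q - a j q) * (b i q - b j q) := by
      rw [hM, hM, hM, hM, ← Finset.sum_add_distrib, ← Finset.sum_sub_distrib,
        ← Finset.sum_sub_distrib]
      exact Finset.sum_congr rfl fun q _ => by ring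
    have h2 : ∀ q ∈ K, (a i q - a j q) * (b i q - b j q) ≤ h ^ 2 / (4 * μ) := by
      intro q hq
      have h3 := hcell i j q hq ((hi.2 q hq).trans (hj.2 q hq).symm)
      have h4 : ((μ * a i q + b i q) - (μ * a j q + b j q)) ^ 2 ≤ h ^ 2 := by
        rw [← sq_abs]
        exact pow_le_pow_left₀ (abs_nonneg _) h3 2
      rw [le_div_iff₀ (by positivity)]
      -- Uses `4 * μ * x * y = (μ * x + y) ^ 2 - (μ * x - y) ^ 2` for the differences `x` of `a` and
      -- `y` of `b`.
      nlinarith [sq_nonneg ((μ * a i q - b i q) - (μ * a j q - b j q))]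
    rw [h1]
    refine (Finset.sum_le_sum h2).trans ?_
    rw [Finset.sum_const, nsmul_eq_mul, mul_div_assoc', div_le_iff₀ (by positivity)]
    linarith
  -- Here 71/100 is a rational just above `1 / √2`; the two endpoints together leave `2 - 2 * 0.71 =
  -- 0.58 > 25/48`.
  have key : ∀ x y : ℝ, x ^ 2 + y ^ 2 < 1 / 4 → |x| + |y| < 71 / 100 := by
    intro x y hxy
    rw [← sq_abs x, ← sq_abs y] at hxy
    nlinarith [sq_nonneg (|x| - |y|), abs_nonneg x, abs_nonneg y]
  have e1 := key _ _ ((sq_add_sq_le_rowError hadj).trans_lt hi.1)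
  have e2 := key _ _ ((sq_add_sq_le_rowError hadj.symm).trans_lt hj.1)
  have := neg_abs_le (M i i - 1)
  have := neg_abs_le (M j j - 1)
  have := le_abs_self (M i j)
  have := le_abs_self (M j i)
  linarith

/-- Pigeonhole: the cell vectors lie in the box `{-m, ..., m} ^ K`. -/
theorem card_le_of_card_cellClass_le {n : ℕ} {S K : Finset (Fin n)} {cell : Fin n → Fin n → ℤ}
    {m t : ℕ} (hm : ∀ i, ∀ q ∈ K, |cell i q| ≤ m)
    (ht : ∀ k ∈ S, (cellClass S K cell k).card ≤ t) :
    S.card ≤ t * (2 * m + 1) ^ K.card := by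
  classical
  have h1 := Finset.card_le_mul_card_image (f := fun i => fun q : K => cell i q) S t (by
    intro b hb
    obtain ⟨k, hk, rfl⟩ := Finset.mem_image.1 hb
    refine le_trans (Finset.card_le_card ?_) (ht k hk)
    intro i hi
    rw [Finset.mem_filter] at hi
    refine Finset.mem_filter.2 ⟨hi.1, fun q hq => congrFun hi.2 ⟨q, hq⟩⟩)
  refine h1.trans (Nat.mul_le_mul_left _ ?_)
  have h2 : (S.image fun i => fun q : K => cell i q) ⊆
      Fintype.piFinset fun _ : K => Finset.Icc (-(m : ℤ)) m := by
    intro f hf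
    obtain ⟨k, hk, rfl⟩ := Finset.mem_image.1 hf
    rw [Fintype.mem_piFinset]
    exact fun q => Finset.mem_Icc.2 (abs_le.1 (hm k q q.2))
  refine (Finset.card_le_card h2).trans ?_
  rw [Fintype.card_piFinset]
  simp only [Int.card_Icc, Finset.prod_const, Finset.card_univ, Fintype.card_coe]
  exact Nat.pow_le_pow_left (by omega) _

/-- The factor `r * √π ≥ 1` in the denominator is simply given away; the grid argument does not need
it. -/
theorem indepBound_le {n r m t g : ℕ} {c ε : ℝ} (hcr : 1 ≤ c * r)
    (hg : (1 - 4 * (c * r) ^ 2 * ε) * n ≤ g) (hgt : g ≤ t * (2 * m + 1) ^ r)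
    (hm : (2 * m + 1 : ℝ) ≤ 8 * √(c * r)) : indepBound n r c ε ≤ t := by
  have hr : (1 : ℝ) ≤ r := by
    have : r ≠ 0 := by
      rintro rfl
      norm_num at hcr
    exact_mod_cast Nat.one_le_iff_ne_zero.2 this
  have hpi : 1 ≤ √Real.pi := Real.one_le_sqrt.2 (by linarith [Real.pi_gt_three])
  have hs : 0 < 8 * √(c * r) := by positivity
  unfold indepBound
  rw [div_le_iff₀ (by positivity)]
  calc (1 - 4 * (c * r) ^ 2 * ε) * n ≤ g := hg
    _ ≤ t * (2 * m + 1 : ℝ) ^ r := by exact_mod_cast hgt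
    _ ≤ t * (8 * √(c * r)) ^ r := by gcongr
    _ ≤ t * (r * √Real.pi * (8 * √(c * r)) ^ r) := by
      refine mul_le_mul_of_nonneg_left ?_ (Nat.cast_nonneg t)
      exact le_mul_of_one_le_left (by positivity) (one_le_mul_of_one_le_of_one_le hr hpi)

/-! ## Bases of the row space and pivoting -/

/-- The matrix whose row `k` is the unit vector `e_k` or row `p` of `N`, as `σ k` prescribes. -/
def basisMatrix {R : Type*} [Zero R] [One R] {n : ℕ} (N : Matrix (Fin n) (Fin n) R)
    (σ : Fin n → Option (Fin n)) : Matrix (Fin n) (Fin n) R :=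
  Matrix.of fun k j => (σ k).elim (if k = j then 1 else 0) fun p => N p j

/-- The coordinates of the rows of `N` in the basis `σ`, scaled by the determinant. -/
def tableau {R : Type*} [CommRing R] {n : ℕ} (N : Matrix (Fin n) (Fin n) R)
    (σ : Fin n → Option (Fin n)) : Matrix (Fin n) (Fin n) R :=
  N * (basisMatrix N σ).adjugate

/-- The positions of the basis that hold rows of the matrix. -/
def rowPositions {n : ℕ} (σ : Fin n → Option (Fin n)) : Finset (Fin n) :=
  Finset.univ.filter fun q => (σ q).isSome

section Pivot

variable {R : Type*} [CommRing R] {n : ℕ}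

theorem basisMatrix_none (N : Matrix (Fin n) (Fin n) R) :
    basisMatrix N (fun _ => none) = 1 := by
  ext i j
  simp [basisMatrix, Matrix.one_apply]

theorem tableau_none (N : Matrix (Fin n) (Fin n) R) : tableau N (fun _ => none) = N := by
  simp [tableau, basisMatrix_none]

theorem basisMatrix_update (N : Matrix (Fin n) (Fin n) R) (σ : Fin n → Option (Fin n))
    (p q : Fin n) : basisMatrix N (Function.update σ q (some p)) =
      (basisMatrix N σ).updateRow q (N p) := by
  ext i j
  by_cases h : i = q
  · subst h
    simp [basisMatrix]
  · simp [basisMatrix, h]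

/-- Cramer's rule. A tableau entry is the determinant of the basis after the corresponding exchange:
it decides whether the exchange is allowed, measures the gain, and is as small as any basis
determinant. -/
theorem tableau_apply (N : Matrix (Fin n) (Fin n) R) (σ : Fin n → Option (Fin n))
    (p q : Fin n) : tableau N σ p q = (basisMatrix N (Function.update σ q (some p))).det := by
  rw [basisMatrix_update, ← Matrix.cramer_transpose_apply, Matrix.cramer_eq_adjugate_mulVec,
    ← Matrix.adjugate_transpose]
  simp [tableau, Matrix.mul_apply, Matrix.mulVec, dotProduct, mul_comm]

theorem tableau_mul_basisMatrix (N : Matrix (Fin n) (Fin n) R) (σ : Fin n → Option (Fin n)) :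
    tableau N σ * basisMatrix N σ = (basisMatrix N σ).det • N := by
  rw [tableau, Matrix.mul_assoc, Matrix.adjugate_mul, Matrix.mul_smul, Matrix.mul_one]

theorem tableau_update_self (N : Matrix (Fin n) (Fin n) R) (σ : Fin n → Option (Fin n))
    (p q i : Fin n) : tableau N (Function.update σ q (some p)) i q = tableau N σ i q := by
  rw [tableau_apply, tableau_apply, Function.update_idem]

/-- The fraction-free pivot rule. Over the integers it shows that the division by the old
determinant is exact. -/
theorem det_mul_tableau_update [IsDomain R] (N : Matrix (Fin n) (Fin n) R)
    (σ : Fin n → Option (Fin n)) (p q : Fin n) (hpq : tableau N σ p q ≠ 0) (i j : Fin n)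
    (hj : j ≠ q) :
    (basisMatrix N σ).det * tableau N (Function.update σ q (some p)) i j =
      tableau N σ i j * tableau N σ p q - tableau N σ i q * tableau N σ p j := by
  set T := tableau N σ with hT
  set D := (basisMatrix N σ).det with hD
  set σ' := Function.update σ q (some p) with hσ'
  have hdet : (basisMatrix N σ').det = T p q := (tableau_apply N σ p q).symm
  have hTB : ∀ i j, ∑ k, T i k * basisMatrix N σ k j = D * N i j := fun i j => by
    have := congrFun (congrFun (tableau_mul_basisMatrix N σ) i) j
    simpa [Matrix.mul_apply] using this
  -- `S` is the expected value of `D` times the new tableau. Both give `(D * T p q) • N` when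
  -- multiplied by the new basis, which is then cancelled by its adjugate and the nonzero pivot.
  let S : Matrix (Fin n) (Fin n) R := Matrix.of fun i j =>
    if j = q then D * T i q else T i j * T p q - T i q * T p j
  have hS : S * basisMatrix N σ' = (D * T p q) • N := by
    ext i j
    rw [Matrix.mul_apply, Matrix.smul_apply, smul_eq_mul, basisMatrix_update]
    have h1 : ∀ k, S i k * ((basisMatrix N σ).updateRow q (N p)) k j =
        (T i k * T p q - T i q * T p k) * basisMatrix N σ k j +
          if k = q then D * T i q * N p j else 0 := by
      intro k
      by_cases hk : k = q
      · subst hk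
        simp only [S, Matrix.of_apply, if_true, Matrix.updateRow_self]
        ring
      · simp [S, hk]
    rw [Finset.sum_congr rfl fun k _ => h1 k, Finset.sum_add_distrib, Finset.sum_ite_eq']
    have h2 : ∑ k, (T i k * T p q - T i q * T p k) * basisMatrix N σ k j
        = T p q * ∑ k, T i k * basisMatrix N σ k j
          - T i q * ∑ k, T p k * basisMatrix N σ k j := by
      rw [Finset.mul_sum, Finset.mul_sum, ← Finset.sum_sub_distrib]
      exact Finset.sum_congr rfl fun k _ => by ring
    rw [h2, hTB, hTB]
    simp only [Finset.mem_univ, if_true]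
    ring
  have h3 : S * basisMatrix N σ' = (D • tableau N σ') * basisMatrix N σ' := by
    rw [hS, Matrix.smul_mul, tableau_mul_basisMatrix, hdet, smul_smul]
  have h4 := congrArg (· * (basisMatrix N σ').adjugate) h3
  simp only [Matrix.mul_assoc, Matrix.mul_adjugate, hdet, Matrix.mul_smul, Matrix.mul_one] at h4
  have h5 := congrFun (congrFun h4 i) j
  simp only [Matrix.smul_apply, smul_eq_mul] at h5
  have h6 := mul_left_cancel₀ hpq h5
  rw [← h6]
  simp [S, hj]

theorem card_rowPositions_update_of_none {σ : Fin n → Option (Fin n)} {q : Fin n}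
    (hq : σ q = none) (p : Fin n) :
    (rowPositions (Function.update σ q (some p))).card = (rowPositions σ).card + 1 := by
  have : rowPositions (Function.update σ q (some p)) = insert q (rowPositions σ) := by
    ext k
    by_cases h : k = q
    · subst h
      simp [rowPositions]
    · simp [rowPositions, h]
  rw [this, Finset.card_insert_of_notMem]
  simp [rowPositions, hq]

theorem rowPositions_update_of_ne_none {σ : Fin n → Option (Fin n)} {q : Fin n}
    (hq : σ q ≠ none) (p : Fin n) :
    rowPositions (Function.update σ q (some p)) = rowPositions σ := by
  ext k
  by_cases h : k = q
  · subst h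
    simp [rowPositions, Option.isSome_iff_ne_none, hq]
  · simp [rowPositions, h]

/-- Pivoting takes place over `ℤ`, rank and factorization live over `ℝ`; this and `map_tableau` link
the two. -/
theorem map_basisMatrix {S : Type*} [CommRing S] (f : R →+* S) (N : Matrix (Fin n) (Fin n) R)
    (σ : Fin n → Option (Fin n)) :
    basisMatrix (N.map f) σ = (basisMatrix N σ).map f := by
  ext k j
  cases h : σ k with
  | none =>
    simp only [basisMatrix, Matrix.of_apply, Matrix.map_apply, h, Option.elim]
    split_ifs <;> simp
  | some p => simp [basisMatrix, h]

theorem map_tableau {S : Type*} [CommRing S] (f : R →+* S) (N : Matrix (Fin n) (Fin n) R)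
    (σ : Fin n → Option (Fin n)) :
    tableau (N.map f) σ = (tableau N σ).map f := by
  ext i j
  rw [tableau_apply, Matrix.map_apply, tableau_apply, map_basisMatrix]
  exact (f.map_det _).symm

end Pivot

section Field

variable {F : Type*} [Field F] {n : ℕ} {N : Matrix (Fin n) (Fin n) F}
  {σ : Fin n → Option (Fin n)}

/-- The low rank factorization: once no unit vector can be exchanged, unit vectors have coefficient
zero in every row. -/
theorem eq_sum_rowPositions (hdet : (basisMatrix N σ).det ≠ 0)
    (hunit : ∀ p q, σ q = none → tableau N σ p q = 0) (i j : Fin n) :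
    N i j = ∑ q ∈ rowPositions σ,
      tableau N σ i q / (basisMatrix N σ).det * basisMatrix N σ q j := by
  have h := congrFun (congrFun (tableau_mul_basisMatrix N σ) i) j
  rw [Matrix.mul_apply, Matrix.smul_apply, smul_eq_mul] at h
  have h2 : ∑ q, tableau N σ i q * basisMatrix N σ q j =
      ∑ q ∈ rowPositions σ, tableau N σ i q * basisMatrix N σ q j := by
    refine (Finset.sum_subset (Finset.subset_univ _) fun q _ hq => ?_).symm
    rw [hunit i q, zero_mul]
    simpa [rowPositions] using hq
  rw [h2] at h
  rw [eq_comm, ← mul_right_inj' hdet, ← h, Finset.mul_sum]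
  exact Finset.sum_congr rfl fun q _ => by field_simp

/-- Upper bound: the tableau factors through the diagonal projection onto the row positions. Lower
bound: the basis rows at these positions are independent rows of `N`. -/
theorem rank_eq_card_rowPositions (hdet : (basisMatrix N σ).det ≠ 0)
    (hunit : ∀ p q, σ q = none → tableau N σ p q = 0) : N.rank = (rowPositions σ).card := by
  classical
  apply le_antisymm
  · let d : Fin n → F := fun q => if (σ q).isSome then 1 else 0
    have hTd : tableau N σ = tableau N σ * Matrix.diagonal d := by
      ext i q
      rw [Matrix.mul_diagonal]
      cases h : σ q with
      | none => simp [hunit i q h]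
      | some p => simp [d, h]
    have hN : N = (basisMatrix N σ).det⁻¹ •
        (tableau N σ * Matrix.diagonal d * basisMatrix N σ) := by
      rw [← hTd, tableau_mul_basisMatrix, smul_smul, inv_mul_cancel₀ hdet, one_smul]
    have hN' : N = (tableau N σ * Matrix.diagonal d) *
        ((basisMatrix N σ).det⁻¹ • basisMatrix N σ) := by
      rw [Matrix.mul_smul]
      exact hN
    rw [hN']
    refine (Matrix.rank_mul_le_left _ _).trans ((Matrix.rank_mul_le_right _ _).trans ?_)
    rw [Matrix.rank_diagonal, Fintype.card_subtype]
    refine Finset.card_le_card fun q hq => ?_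
    simpa [rowPositions, d, Option.isSome_iff_ne_none] using hq
  · have hli : LinearIndependent F (basisMatrix N σ).row :=
      Matrix.linearIndependent_rows_iff_isUnit.2
        ((Matrix.isUnit_iff_isUnit_det _).2 (isUnit_iff_ne_zero.2 hdet))
    have hli' := hli.comp (fun q : rowPositions σ => (q : Fin n)) Subtype.val_injective
    rw [Matrix.rank_eq_finrank_span_row]
    have hspan := finrank_span_eq_card hli'
    rw [Fintype.card_coe] at hspan
    rw [← hspan]
    refine Submodule.finrank_mono (Submodule.span_mono ?_)
    rintro _ ⟨⟨q, hq⟩, rfl⟩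
    obtain ⟨p, hp⟩ := Option.isSome_iff_exists.1 (Finset.mem_filter.1 hq).2
    refine ⟨p, ?_⟩
    have hrow : basisMatrix N σ q = N p := by
      ext j
      simp [basisMatrix, hp]
    exact hrow.symm

end Field

/-- Over a finite family of candidate bases, one with as many rows of the matrix as possible and
then of the largest determinant admits no improving pivot. -/
theorem exists_maximal_basis {n : ℕ} (N : Matrix (Fin n) (Fin n) ℝ) :
    ∃ σ : Fin n → Option (Fin n), (basisMatrix N σ).det ≠ 0 ∧
      (∀ p q, σ q = none → tableau N σ p q = 0) ∧
      ∀ p q, σ q ≠ none → |tableau N σ p q| ≤ |(basisMatrix N σ).det| := by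
  classical
  obtain ⟨σ, hσ, hmax⟩ := Finset.exists_max_image
    (Finset.univ.filter fun σ : Fin n → Option (Fin n) => (basisMatrix N σ).det ≠ 0)
    (fun σ => toLex ((rowPositions σ).card, |(basisMatrix N σ).det|))
    ⟨fun _ => none, by simp [basisMatrix_none]⟩
  simp only [Finset.mem_filter, Finset.mem_univ, true_and] at hσ hmax
  refine ⟨σ, hσ, fun p q hq => ?_, fun p q hq => ?_⟩
  · by_contra h
    -- The exchanged basis is nonsingular by `tableau_apply`, so it competes in the maximum, and it
    -- would hold one more row.
    have := hmax (Function.update σ q (some p)) (by rwa [← tableau_apply])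
    rw [card_rowPositions_update_of_none hq, Prod.Lex.toLex_le_toLex] at this
    rcases this with h1 | h1
    · simp at h1
    · simp at h1
  · by_contra! h
    have h0 : tableau N σ p q ≠ 0 := fun h0 => by
      rw [h0, abs_zero] at h
      exact absurd (abs_nonneg _) (not_le.2 h)
    have := hmax (Function.update σ q (some p)) (by rwa [← tableau_apply])
    rw [rowPositions_update_of_ne_none hq, Prod.Lex.toLex_le_toLex, ← tableau_apply] at this
    rcases this with h1 | h1
    · exact absurd h1 (lt_irrefl _)
    · exact absurd h1.2 (not_le.2 h)

/-! ### Existence of the independent set. -/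

theorem exists_indepSet {n r : ℕ} {c ε : ℝ} {G : SimpleGraph (Fin n)}
    {M : Matrix (Fin n) (Fin n) ℝ} (hcr : 1 ≤ c * r) (h : IsApproxCompletion G M r c ε) :
    ∃ T : Finset (Fin n), G.IsIndepSet (T : Set (Fin n)) ∧ indepBound n r c ε ≤ (T.card : ℝ) := by
  classical
  obtain ⟨σ, hdet, hunit, hle⟩ := exists_maximal_basis M
  have hrank := rank_eq_card_rowPositions hdet hunit
  rw [h.rank_eq] at hrank
  have hc : 0 < c := by
    by_contra! hc
    have : c * r ≤ 0 := mul_nonpos_of_nonpos_of_nonneg hc (Nat.cast_nonneg r)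
    linarith
  have hr : 0 < (r : ℝ) := pos_of_mul_pos_right (by linarith : 0 < c * r) hc.le
  -- `3 * c * r ≤ m ^ 2` is exactly what `r * w ^ 2 ≤ 25 / 12 * c` needs for the width `w` below,
  -- and `2 * m + 1 < 4 * √(c * r) + 3 ≤ 7 * √(c * r)`.
  set m : ℕ := ⌈√(3 * (c * r))⌉₊ with hm
  have hm0 : √(3 * (c * r)) ≤ m := Nat.le_ceil _
  have hm1 : (m : ℝ) < √(3 * (c * r)) + 1 := Nat.ceil_lt_add_one (Real.sqrt_nonneg _)
  have hmpos : (0 : ℝ) < m := lt_of_lt_of_le (Real.sqrt_pos.2 (by positivity)) hm0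
  have hmsq : 3 * (c * r) ≤ (m : ℝ) ^ 2 := (Real.sqrt_le_left hmpos.le).1 hm0
  have hx1 : 1 ≤ √(c * r) := Real.one_le_sqrt.2 hcr
  have hmx : (2 * m + 1 : ℝ) ≤ 8 * √(c * r) := by
    have h3 : √(3 * (c * r)) = √3 * √(c * r) := Real.sqrt_mul (by norm_num) _
    have h4 : √3 ≤ 2 := (Real.sqrt_le_left (by norm_num)).2 (by norm_num)
    rw [h3] at hm1
    nlinarith
  set D := (basisMatrix M σ).det
  set a : Fin n → Fin n → ℝ := fun i q => tableau M σ i q / D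
  set b : Fin n → Fin n → ℝ := fun j q => basisMatrix M σ q j
  -- The cells `-m, ..., m` cover `|c * a + b| ≤ 5 * c / 2`. Here `2 * c` would suffice; the
  -- algorithm, with `|a| ≤ 3/2`, uses the full range.
  set w : ℝ := 5 * c / (2 * m) with hw
  have hwpos : 0 < w := by positivity
  set cell : Fin n → Fin n → ℤ := fun i q => ⌊(c * a i q + b i q) / w⌋ with hcell
  have ha : ∀ i, ∀ q ∈ rowPositions σ, |a i q| ≤ 1 := by
    intro i q hq
    have hq' : σ q ≠ none := Option.isSome_iff_ne_none.1 (Finset.mem_filter.1 hq).2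
    rw [abs_div]
    exact div_le_one_of_le₀ (hle i q hq') (abs_nonneg _)
  have hb : ∀ i, ∀ q ∈ rowPositions σ, |b i q| ≤ c := by
    intro i q hq
    obtain ⟨p, hp⟩ := Option.isSome_iff_exists.1 (Finset.mem_filter.1 hq).2
    simpa [b, basisMatrix, hp] using h.abs_le p i
  have hcells : ∀ i, ∀ q ∈ rowPositions σ, |cell i q| ≤ m := by
    intro i q hq
    have h1 : |c * a i q + b i q| ≤ 2 * c := by
      have h2 := abs_add_le (c * a i q) (b i q)
      rw [abs_mul, abs_of_pos hc] at h2
      nlinarith [ha i q hq, hb i q hq]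
    have hwm : w * m = 5 * c / 2 := by
      rw [hw]
      field_simp
    obtain ⟨h3, h4⟩ := abs_le.1 h1
    rw [abs_le]
    constructor
    · rw [hcell, Int.le_floor, le_div_iff₀ hwpos]
      push_cast
      nlinarith
    · have h5 : (c * a i q + b i q) / w ≤ m := by
        rw [div_le_iff₀ hwpos]
        nlinarith
      exact_mod_cast (Int.floor_le _).trans h5
  obtain ⟨t, ht⟩ : ∃ t, (∀ k, (cellClass (goodSet G M) (rowPositions σ) cell k).card ≤ t) ∧
      ∃ k, (cellClass (goodSet G M) (rowPositions σ) cell k).card = t := by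
    have hn : Nonempty (Fin n) := by
      obtain ⟨q, _⟩ := Finset.card_pos.1 (by rw [← hrank]; exact_mod_cast hr :
        0 < (rowPositions σ).card)
      exact ⟨q⟩
    obtain ⟨k, _, hk⟩ := Finset.exists_max_image Finset.univ
      (fun k => (cellClass (goodSet G M) (rowPositions σ) cell k).card) Finset.univ_nonempty
    exact ⟨_, fun j => hk j (Finset.mem_univ j), k, rfl⟩
  obtain ⟨k, hk⟩ := ht.2
  refine ⟨cellClass (goodSet G M) (rowPositions σ) cell k, ?_, ?_⟩
  · refine isIndepSet_cellClass (a := a) (b := b) (μ := c) (h := w)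
      (eq_sum_rowPositions hdet hunit) hc ?_ ?_ k
    · intro i j q _ hij
      have h1 := Int.abs_sub_lt_one_of_floor_eq_floor hij
      rw [← sub_div, abs_div, abs_of_pos hwpos, div_lt_one hwpos] at h1
      exact h1.le
    · rw [← hrank, hw, div_pow, mul_div_assoc', div_le_iff₀ (by positivity)]
      nlinarith [mul_le_mul_of_nonneg_left hmsq hc.le]
  · rw [hk]
    refine indepBound_le hcr (le_card_goodSet hcr h) ?_ hmx
    rw [hrank]
    exact card_le_of_card_cellClass_le hcells fun k _ => ht.1 k

/-! ## Cost-bounded execution of programs -/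

namespace LogRAM

theorem one_le_bits (z : ℤ) : 1 ≤ bits z := Nat.le_add_left _ _

theorem bits_le_of_abs_le {z : ℤ} {H : ℕ} (h : |z| ≤ H) : bits z ≤ H.size + 1 :=
  Nat.succ_le_succ (Nat.size_le_size (by rw [Int.abs_eq_natAbs] at h; exact_mod_cast h))

theorem bits_le_of_natAbs_lt {z : ℤ} {k : ℕ} (h : z.natAbs < 2 ^ k) : bits z ≤ k + 1 :=
  Nat.succ_le_succ (Nat.size_le.2 h)

theorem natAbs_lt_two_pow_bits (z : ℤ) : z.natAbs < 2 ^ (bits z - 1) := by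
  simpa [bits] using Nat.lt_size_self z.natAbs

theorem bits_add_le (x y : ℤ) : bits (x + y) ≤ bits x + bits y := by
  have hx := natAbs_lt_two_pow_bits x
  have hy := natAbs_lt_two_pow_bits y
  have hbx := one_le_bits x
  have hby := one_le_bits y
  have h1 : 2 ^ (bits x - 1) ≤ 2 ^ (bits x + bits y - 2) :=
    Nat.pow_le_pow_right (by norm_num) (by omega)
  have h2 : 2 ^ (bits y - 1) ≤ 2 ^ (bits x + bits y - 2) :=
    Nat.pow_le_pow_right (by norm_num) (by omega)
  have h3 : 2 ^ (bits x + bits y - 1) = 2 ^ (bits x + bits y - 2) * 2 := by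
    rw [← pow_succ]
    congr 1
    omega
  have h4 : bits (x + y) ≤ bits x + bits y - 1 + 1 := bits_le_of_natAbs_lt (by omega)
  omega

theorem bits_neg (x : ℤ) : bits (-x) = bits x := by simp [bits]

theorem bits_sub_le (x y : ℤ) : bits (x - y) ≤ bits x + bits y := by
  simpa [sub_eq_add_neg, bits_neg] using bits_add_le x (-y)

theorem bits_mul_le (x y : ℤ) : bits (x * y) ≤ bits x + bits y := by
  have hx := natAbs_lt_two_pow_bits x
  have hy := natAbs_lt_two_pow_bits y
  have hbx := one_le_bits x
  have hby := one_le_bits y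
  have h1 : (x * y).natAbs < 2 ^ (bits x + bits y - 2) := by
    rw [Int.natAbs_mul, show bits x + bits y - 2 = (bits x - 1) + (bits y - 1) by omega, pow_add]
    exact Nat.mul_lt_mul'' hx hy
  have := bits_le_of_natAbs_lt h1
  omega

theorem bits_div_le (x y : ℤ) : bits (x / y) ≤ bits x :=
  Nat.succ_le_succ (Nat.size_le_size (Int.natAbs_ediv_le_natAbs x y))

/-- The number of nodes of an expression, constants counted with their bit length. -/
def Expr.weight : Expr → ℕ
  | .const z => bits z
  | .var _ => 1
  | .get _ i => i.weight + 1
  | .add e f => e.weight + f.weight + 1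
  | .sub e f => e.weight + f.weight + 1
  | .mul e f => e.weight + f.weight + 1
  | .div e f => e.weight + f.weight + 1

/-- All the values in the memory are at most `H` in absolute value. -/
def State.Within (s : State) (H : ℕ) : Prop :=
  (∀ x, |s.var x| ≤ H) ∧ ∀ a z, |s.arr a z| ≤ H

/-- For all four operations the bit length of the result is at most the sum of those of the
operands. -/
theorem Expr.bits_eval_le {s : State} {H : ℕ} (hs : s.Within H) (e : Expr) :
    bits (e.eval s) ≤ e.weight * (H.size + 1) := by
  induction e with
  | const z => exact Nat.le_mul_of_pos_right _ (Nat.succ_pos _)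
  | var x => simpa [Expr.weight, Expr.eval] using bits_le_of_abs_le (hs.1 x)
  | get a i _ =>
    have := bits_le_of_abs_le (hs.2 a (i.eval s))
    simp only [Expr.eval, Expr.weight]
    nlinarith
  | add e f he hf =>
    have := bits_add_le (e.eval s) (f.eval s)
    simp only [Expr.eval, Expr.weight]
    nlinarith
  | sub e f he hf =>
    have := bits_sub_le (e.eval s) (f.eval s)
    simp only [Expr.eval, Expr.weight]
    nlinarith
  | mul e f he hf =>
    have := bits_mul_le (e.eval s) (f.eval s)
    simp only [Expr.eval, Expr.weight]
    nlinarith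
  | div e f he hf =>
    have := bits_div_le (e.eval s) (f.eval s)
    simp only [Expr.eval, Expr.weight]
    nlinarith

/-- One factor `weight` accounts for the subexpressions, the other for the length of each value. -/
theorem Expr.cost_le {s : State} {H : ℕ} (hs : s.Within H) (e : Expr) :
    e.cost s ≤ e.weight ^ 2 * (H.size + 1) := by
  have key : ∀ (e f g : Expr), g.weight = e.weight + f.weight + 1 →
      e.cost s ≤ e.weight ^ 2 * (H.size + 1) → f.cost s ≤ f.weight ^ 2 * (H.size + 1) →
      e.cost s + f.cost s + bits (g.eval s) ≤ g.weight ^ 2 * (H.size + 1) := by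
    intro e f g hg he hf
    have hb := g.bits_eval_le hs
    rw [hg] at hb ⊢
    calc e.cost s + f.cost s + bits (g.eval s)
        ≤ e.weight ^ 2 * (H.size + 1) + f.weight ^ 2 * (H.size + 1)
          + (e.weight + f.weight + 1) * (H.size + 1) := by omega
      _ = (e.weight ^ 2 + f.weight ^ 2 + (e.weight + f.weight + 1)) * (H.size + 1) := by ring
      _ ≤ (e.weight + f.weight + 1) ^ 2 * (H.size + 1) :=
        Nat.mul_le_mul_right _ (by nlinarith)
  induction e with
  | const z =>
    have h1 := one_le_bits z
    simp only [Expr.cost, Expr.weight]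
    nlinarith [Nat.zero_le (bits z ^ 2 * H.size)]
  | var x => simpa [Expr.cost, Expr.weight] using bits_le_of_abs_le (hs.1 x)
  | get a i hi =>
    have := bits_le_of_abs_le (hs.2 a (i.eval s))
    simp only [Expr.cost, Expr.weight]
    nlinarith [Nat.zero_le (i.weight * (H.size + 1))]
  | add e f he hf => exact key e f (.add e f) rfl he hf
  | sub e f he hf => exact key e f (.sub e f) rfl he hf
  | mul e f he hf => exact key e f (.mul e f) rfl he hf
  | div e f he hf => exact key e f (.div e f) rfl he hf

/-- The variables that a program may change. -/
def Prog.wvars : Prog → List ℕ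
  | .skip => []
  | .assign x _ => [x]
  | .put _ _ _ => []
  | .seq p q => p.wvars ++ q.wvars
  | .ite _ p q => p.wvars ++ q.wvars
  | .while _ p => p.wvars

/-- The arrays that a program may change. -/
def Prog.warrs : Prog → List ℕ
  | .skip => []
  | .assign _ _ => []
  | .put a _ _ => [a]
  | .seq p q => p.warrs ++ q.warrs
  | .ite _ p q => p.warrs ++ q.warrs
  | .while _ p => p.warrs

/-- A frame rule. For a concrete program its hypothesis is decidable, so untouched memory is carried
along by `decide`. -/
theorem Exec.var_eq {p : Prog} {s s' : State} {t : ℕ} (h : Exec p s s' t) {x : ℕ}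
    (hx : x ∉ p.wvars) : s'.var x = s.var x := by
  induction h with
  | skip => rfl
  | assign y e s =>
    have : x ≠ y := by simpa [Prog.wvars] using hx
    simp [State.setVar, this]
  | put => rfl
  | seq _ _ h1 h2 =>
    simp only [Prog.wvars, List.mem_append, not_or] at hx
    rw [h2 hx.2, h1 hx.1]
  | ite_true _ _ h1 =>
    simp only [Prog.wvars, List.mem_append, not_or] at hx
    exact h1 hx.1
  | ite_false _ _ h1 =>
    simp only [Prog.wvars, List.mem_append, not_or] at hx
    exact h1 hx.2
  | while_true _ _ _ h1 h2 => rw [h2 hx, h1 hx]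
  | while_false => rfl

theorem Exec.arr_eq {p : Prog} {s s' : State} {t : ℕ} (h : Exec p s s' t) {a : ℕ}
    (ha : a ∉ p.warrs) : s'.arr a = s.arr a := by
  induction h with
  | skip => rfl
  | assign => rfl
  | put b i e s =>
    have : a ≠ b := by simpa [Prog.warrs] using ha
    simp [State.setArr, this]
  | seq _ _ h1 h2 =>
    simp only [Prog.warrs, List.mem_append, not_or] at ha
    rw [h2 ha.2, h1 ha.1]
  | ite_true _ _ h1 =>
    simp only [Prog.warrs, List.mem_append, not_or] at ha
    exact h1 ha.1
  | ite_false _ _ h1 =>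
    simp only [Prog.warrs, List.mem_append, not_or] at ha
    exact h1 ha.2
  | while_true _ _ _ h1 h2 => rw [h2 ha, h1 ha]
  | while_false => rfl

/-- The program `p` leads from `s` to `s'` in at most `k` steps on values bounded by `H`. -/
def Run (H : ℕ) (p : Prog) (s s' : State) (k : ℕ) : Prop :=
  s.Within H ∧ s'.Within H ∧ ∃ t, Exec p s s' t ∧ t ≤ k * (H.size + 1)

namespace Run

variable {H : ℕ} {p q : Prog} {s s₁ s₂ : State} {k l : ℕ}

theorem within (h : Run H p s s₁ k) : s₁.Within H := h.2.1

theorem var_eq (h : Run H p s s₁ k) (x : ℕ) (hx : x ∉ p.wvars) : s₁.var x = s.var x :=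
  h.2.2.elim fun _ ht => ht.1.var_eq hx

theorem arr_eq (h : Run H p s s₁ k) (a : ℕ) (ha : a ∉ p.warrs) : s₁.arr a = s.arr a :=
  h.2.2.elim fun _ ht => ht.1.arr_eq ha

theorem seq (h₁ : Run H p s s₁ k) (h₂ : Run H q s₁ s₂ l) : Run H (.seq p q) s s₂ (k + l) := by
  obtain ⟨hs, -, t₁, e₁, ht₁⟩ := h₁
  obtain ⟨-, hs₂, t₂, e₂, ht₂⟩ := h₂
  exact ⟨hs, hs₂, _, .seq e₁ e₂, by rw [add_mul]; omega⟩

theorem assign (hs : s.Within H) (x : ℕ) (e : Expr) (he : |e.eval s| ≤ H) :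
    Run H (.assign x e) s (s.setVar x (e.eval s)) (e.weight ^ 2 + 1) := by
  refine ⟨hs, ⟨fun y => ?_, hs.2⟩, _, .assign x e s, ?_⟩
  · by_cases h : y = x
    · subst h
      simpa [State.setVar] using he
    · simpa [State.setVar, h] using hs.1 y
  · have := e.cost_le hs
    rw [add_mul]
    omega

theorem put (hs : s.Within H) (a : ℕ) (i e : Expr) (he : |e.eval s| ≤ H) :
    Run H (.put a i e) s (s.setArr a (i.eval s) (e.eval s)) (i.weight ^ 2 + e.weight ^ 2 + 1) := by
  refine ⟨hs, ⟨hs.1, fun b z => ?_⟩, _, .put a i e s, ?_⟩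
  · by_cases h : b = a
    · subst h
      by_cases hz : z = i.eval s
      · subst hz
        simpa [State.setArr] using he
      · simpa [State.setArr, hz] using hs.2 b z
    · simpa [State.setArr, h] using hs.2 b z
  · have := e.cost_le hs
    have := i.cost_le hs
    rw [add_mul, add_mul]
    omega

/-- The invariant carries its own measure, which falls with each round; `μ + 1` counts the guard
evaluations, the failing one included. -/
theorem while_of_measure {e : Expr} (Inv : ℕ → State → Prop)
    (hstep : ∀ μ s, s.Within H → Inv μ s → 0 < e.eval s →
      ∃ s' μ', Run H p s s' k ∧ μ' < μ ∧ Inv μ' s') :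
    ∀ μ s, s.Within H → Inv μ s → ∃ s' μ',
      Run H (.while e p) s s' ((μ + 1) * (k + e.weight ^ 2 + 1)) ∧ Inv μ' s' ∧ e.eval s' ≤ 0 := by
  intro μ
  induction μ using Nat.strong_induction_on with
  | _ μ ih =>
    intro s hs hI
    have hc := e.cost_le hs
    rcases le_or_gt (e.eval s) 0 with h | h
    · refine ⟨s, μ, ⟨hs, hs, _, .while_false h, ?_⟩, hI, h⟩
      calc e.cost s + 1 ≤ e.weight ^ 2 * (H.size + 1) + 1 * (H.size + 1) := by omega
        _ = (e.weight ^ 2 + 1) * (H.size + 1) := by ring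
        _ ≤ (μ + 1) * (k + e.weight ^ 2 + 1) * (H.size + 1) :=
          Nat.mul_le_mul_right _ (by nlinarith [Nat.zero_le (μ * (k + e.weight ^ 2 + 1))])
    · obtain ⟨s₁, μ₁, ⟨-, hs₁, t₁, e₁, ht₁⟩, hμ, hI₁⟩ := hstep μ s hs hI h
      obtain ⟨s₂, μ₂, ⟨-, hs₂, t₂, e₂, ht₂⟩, hI₂, h₂⟩ := ih μ₁ hμ s₁ hs₁ hI₁
      refine ⟨s₂, μ₂, ⟨hs, hs₂, _, .while_true h e₁ e₂, ?_⟩, hI₂, h₂⟩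
      calc e.cost s + t₁ + t₂ + 1
          ≤ e.weight ^ 2 * (H.size + 1) + k * (H.size + 1)
            + (μ₁ + 1) * (k + e.weight ^ 2 + 1) * (H.size + 1) + 1 * (H.size + 1) := by omega
        _ = ((μ₁ + 1 + 1) * (k + e.weight ^ 2 + 1)) * (H.size + 1) := by ring
        _ ≤ (μ + 1) * (k + e.weight ^ 2 + 1) * (H.size + 1) :=
          Nat.mul_le_mul_right _ (Nat.mul_le_mul_right _ (by omega))

end Run

/-! ### Counting loops: filling, folding and row sums. -/

/-- The loop in which variable `i` runs from `0` up to the value of variable `y`. -/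
def forTo (i y : ℕ) (p : Prog) : Prog :=
  .seq (.assign i (.const 0)) (.while (.sub (.var y) (.var i))
    (.seq p (.assign i (.add (.var i) (.const 1)))))

theorem Run.forTo {H N k i y : ℕ} {p : Prog} {s : State} (Inv : ℕ → State → Prop)
    (hs : s.Within H) (hiy : y ≠ i) (hip : i ∉ p.wvars) (hyp : y ∉ p.wvars) (hy : s.var y = N)
    (h0 : Inv 0 (s.setVar i 0))
    (hstep : ∀ j : ℕ, j < N → ∀ s₁ : State, s₁.Within H → s₁.var i = (j : ℤ) → Inv j s₁ →
      ∃ s₂, Run H p s₁ s₂ k ∧ Inv (j + 1) (s₂.setVar i (j + 1 : ℕ))) :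
    ∃ s', Run H (forTo i y p) s s' ((N + 1) * (k + 30)) ∧ Inv N s' := by
  have hNH : N ≤ H := by
    have := hs.1 y
    rw [hy] at this
    simpa using this
  have hr := Run.assign hs i (.const 0) (by simp [Expr.eval])
  -- Incrementing the counter costs 17 units, a guard 10 and the initialization 2, which fits into
  -- the 30 per round.
  obtain ⟨s', μ', hrun, ⟨j, hj, hi', hy', hI⟩, he⟩ := Run.while_of_measure (k := k + 17) (H := H)
    (e := .sub (.var y) (.var i)) (p := .seq p (.assign i (.add (.var i) (.const 1))))
    (fun μ s => ∃ j : ℕ, j + μ = N ∧ s.var i = j ∧ s.var y = N ∧ Inv j s) (by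
      rintro μ s₁ hs₁ ⟨j, hj, hji, hjy, hI⟩ hpos
      simp only [Expr.eval, hji, hjy] at hpos
      obtain ⟨s₂, hr₂, hI₂⟩ := hstep j (by omega) s₁ hs₁ hji hI
      have hi₂ := hr₂.var_eq i hip
      have hy₂ := hr₂.var_eq y hyp
      have hev : (Expr.add (.var i) (.const 1)).eval s₂ = (j + 1 : ℕ) := by
        simp [Expr.eval, hi₂, hji]
      have hr₃ := Run.assign hr₂.within i (.add (.var i) (.const 1)) (by
        rw [hev, Nat.abs_cast]
        exact_mod_cast (by omega : j + 1 ≤ H))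
      rw [hev] at hr₃
      refine ⟨_, μ - 1, hr₂.seq hr₃, by omega, j + 1, by omega, ?_, ?_, hI₂⟩
      · simp [State.setVar]
      · simp [State.setVar, hiy, hy₂, hjy])
    N _ hr.within ⟨0, by simp, by simp [State.setVar, Expr.eval],
      by simp [State.setVar, hiy, hy], h0⟩
  simp only [Expr.eval, hi', hy'] at he
  obtain rfl : j = N := by omega
  refine ⟨s', ?_, hI⟩
  obtain ⟨h1, h2, t, ht, hle⟩ := hr.seq hrun
  refine ⟨h1, h2, t, ht, hle.trans (Nat.mul_le_mul_right _ ?_)⟩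
  have hw0 : (Expr.const 0).weight = 1 := by decide
  have hw : (Expr.sub (.var y) (.var i)).weight = 3 := rfl
  rw [hw, hw0]
  nlinarith

/-- Set the entries of array `a` with index below variable `y` to the values of `e`, which may
refer to the index as variable `i`. -/
def fill (i y a : ℕ) (e : Expr) : Prog := forTo i y (.put a (.var i) e)

/-- Quantifying over `g` says that `e` does not depend on the array being overwritten, so partial
fillings need not be described. -/
theorem Run.fill {H N i y a : ℕ} {e : Expr} {s : State} (f : ℕ → ℤ) (hs : s.Within H)
    (hiy : y ≠ i) (hy : s.var y = N)
    (hf : ∀ z < N, ∀ g, e.eval ⟨Function.update s.var i z, Function.update s.arr a g⟩ = f z ∧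
      |f z| ≤ H) :
    ∃ g : ℤ → ℤ, Run H (fill i y a e) s
      ⟨Function.update s.var i N, Function.update s.arr a g⟩ ((N + 1) * (e.weight ^ 2 + 40)) ∧
      ∀ z < N, g z = f z := by
  obtain ⟨s', hr, g, rfl, hg⟩ := Run.forTo (k := e.weight ^ 2 + 2) (p := .put a (.var i) e)
    (fun j s' => ∃ g : ℤ → ℤ, s' = ⟨Function.update s.var i j, Function.update s.arr a g⟩ ∧
      ∀ z < j, g z = f z) hs hiy (by simp [Prog.wvars]) (by simp [Prog.wvars]) hy
    ⟨s.arr a, by simp [State.setVar], by simp⟩ (by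
      rintro j hj s₁ hs₁ - ⟨g, rfl, hg⟩
      obtain ⟨he, hb⟩ := hf j hj g
      have hr := Run.put hs₁ a (.var i) e (by rwa [he])
      have hw : (Expr.var i).weight ^ 2 + e.weight ^ 2 + 1 = e.weight ^ 2 + 2 := by
        simp only [Expr.weight]
        ring
      rw [he, hw] at hr
      refine ⟨_, hr, Function.update g j (f j), ?_, ?_⟩
      · simp [State.setVar, State.setArr, Expr.eval]
      · intro z hz
        rcases Nat.lt_succ_iff_lt_or_eq.1 hz with h | rfl
        · rw [Function.update_of_ne (by exact_mod_cast h.ne), hg z h]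
        · simp)
  refine ⟨g, ?_, hg⟩
  obtain ⟨h1, h2, t, ht, hle⟩ := hr
  exact ⟨h1, h2, t, ht, hle.trans (Nat.mul_le_mul_right _ (Nat.mul_le_mul_left _ (by omega)))⟩

/-- Repeat the assignment `v := e` for the values of variable `i` below variable `y`. -/
def fold (i y v : ℕ) (e : Expr) : Prog := forTo i y (.assign v e)

/-- `f z` prescribes the accumulator after `z` rounds, so its bound is required for `f (z + 1)`. -/
theorem Run.fold {H N i y v : ℕ} {e : Expr} {s : State} (f : ℕ → ℤ) (hs : s.Within H)
    (hiy : y ≠ i) (hvy : y ≠ v) (hiv : i ≠ v) (hy : s.var y = N) (h0 : f 0 = s.var v)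
    (hf : ∀ z < N, e.eval ⟨Function.update (Function.update s.var v (f z)) i z, s.arr⟩ = f (z + 1) ∧
      |f (z + 1)| ≤ H) :
    Run H (fold i y v e) s ⟨Function.update (Function.update s.var v (f N)) i N, s.arr⟩
      ((N + 1) * (e.weight ^ 2 + 40)) := by
  obtain ⟨s', hr, rfl⟩ := Run.forTo (k := e.weight ^ 2 + 1) (p := .assign v e)
    (fun j s' => s' = ⟨Function.update (Function.update s.var v (f j)) i j, s.arr⟩) hs hiy
    (by simpa [Prog.wvars] using hiv) (by simpa [Prog.wvars] using hvy) hy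
    (by simp [State.setVar, h0]) (by
      rintro j hj s₁ hs₁ - rfl
      obtain ⟨he, hb⟩ := hf j hj
      have hr := Run.assign hs₁ v e (by rwa [he])
      rw [he] at hr
      refine ⟨_, hr, ?_⟩
      simp only [State.setVar]
      rw [Function.update_comm hiv, Function.update_idem, Function.update_idem])
  obtain ⟨h1, h2, t, ht, hle⟩ := hr
  exact ⟨h1, h2, t, ht, hle.trans (Nat.mul_le_mul_right _ (Nat.mul_le_mul_left _ (by omega)))⟩

/-- Add the values of `e` on row `w` of an array with rows of length `n` (variable `0`) to entry
`w` of array `a`. -/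
def rowSum (i y a : ℕ) (e : Expr) : Prog :=
  forTo i y (.put a (.div (.var i) (.var 0)) (.add (.get a (.div (.var i) (.var 0))) e))

/-- A single loop over the flat index replaces a nested one: the quotient by `n` selects the
accumulator. Since the terms are nonnegative, partial sums obey the bound on the full sums. -/
theorem Run.rowSum {H n R i y a : ℕ} {e : Expr} {s : State} (f : ℕ → ℤ) (hs : s.Within H)
    (hiy : y ≠ i) (hi0 : i ≠ 0) (hy : s.var y = (R * n : ℕ)) (hn : s.var 0 = n)
    (ha : ∀ w < R, s.arr a (w : ℕ) = 0) (hf0 : ∀ z, 0 ≤ f z)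
    (hfH : ∀ w < R, ∑ j ∈ Finset.range n, f (w * n + j) ≤ H)
    (hf : ∀ z < R * n, ∀ g,
      e.eval ⟨Function.update s.var i z, Function.update s.arr a g⟩ = f z) :
    ∃ g : ℤ → ℤ, Run H (rowSum i y a e) s
      ⟨Function.update s.var i (R * n : ℕ), Function.update s.arr a g⟩
      ((R * n + 1) * ((e.weight + 6) ^ 2 + 40)) ∧
      ∀ w < R, g (w : ℕ) = ∑ j ∈ Finset.range n, f (w * n + j) := by
  have hwt : (Expr.div (.var i) (.var 0)).weight = 3 := rfl
  obtain ⟨s', hr, g, rfl, hg⟩ := Run.forTo (k := 9 + (e.weight + 5) ^ 2 + 1)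
    (p := .put a (.div (.var i) (.var 0)) (.add (.get a (.div (.var i) (.var 0))) e))
    (fun Z s' => ∃ g : ℤ → ℤ, s' = ⟨Function.update s.var i Z, Function.update s.arr a g⟩ ∧
      ∀ w < R, g (w : ℕ) =
        ∑ j ∈ Finset.range n, if w * n + j < Z then f (w * n + j) else 0) hs hiy
    (by simp [Prog.wvars]) (by simp [Prog.wvars]) hy
    ⟨s.arr a, by simp [State.setVar], by simpa using ha⟩ (by
      rintro z hz s₁ hs₁ - ⟨g, rfl, hg⟩
      have hn0 : 0 < n := Nat.pos_of_ne_zero (by rintro rfl; simp at hz)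
      have hw : z / n < R := Nat.div_lt_of_lt_mul (by rwa [mul_comm])
      have hidx : (Expr.div (.var i) (.var 0)).eval
          ⟨Function.update s.var i z, Function.update s.arr a g⟩ = (z / n : ℕ) := by
        simp [Expr.eval, hi0.symm, hn]
      have hstep : ∀ w < R,
          (∑ j ∈ Finset.range n, if w * n + j < z + 1 then f (w * n + j) else 0) =
          (∑ j ∈ Finset.range n, if w * n + j < z then f (w * n + j) else 0) +
            if w = z / n then f z else 0 := by
        intro w _
        have h1 : ∀ j ∈ Finset.range n, (if w * n + j < z + 1 then f (w * n + j) else 0) =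
            (if w * n + j < z then f (w * n + j) else 0) +
              if j = z % n then (if w = z / n then f z else 0) else 0 := by
          intro j hj
          have hjn := Finset.mem_range.1 hj
          by_cases heq : w * n + j = z
          · have hq : z / n = w := by
              rw [← heq, add_comm, Nat.add_mul_div_right _ _ hn0, Nat.div_eq_of_lt hjn, zero_add]
            have hm : z % n = j := by
              rw [← heq, add_comm, Nat.add_mul_mod_self_right, Nat.mod_eq_of_lt hjn]
            simp [heq, hq, hm]
          · have : ¬(j = z % n ∧ w = z / n) := by
              rintro ⟨rfl, rfl⟩
              exact heq (by rw [mul_comm]; exact Nat.div_add_mod z n)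
            have h2 : (if j = z % n then (if w = z / n then f z else 0) else 0) = 0 := by
              by_cases h3 : j = z % n
              · rw [if_pos h3, if_neg fun h4 => this ⟨h3, h4⟩]
              · rw [if_neg h3]
            rw [h2, add_zero]
            exact if_congr (by omega) rfl rfl
        rw [Finset.sum_congr rfl h1, Finset.sum_add_distrib, Finset.sum_ite_eq',
          if_pos (Finset.mem_range.2 (Nat.mod_lt _ hn0))]
      have hev : (Expr.add (.get a (.div (.var i) (.var 0))) e).eval
          ⟨Function.update s.var i z, Function.update s.arr a g⟩ =
          ∑ j ∈ Finset.range n, if z / n * n + j < z + 1 then f (z / n * n + j) else 0 := by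
        rw [hstep _ hw, if_pos rfl, ← hg _ hw]
        simp only [Expr.eval] at hidx ⊢
        rw [hidx, hf z hz]
        simp
      have hr := Run.put hs₁ a (.div (.var i) (.var 0))
        (.add (.get a (.div (.var i) (.var 0))) e) (by
          rw [hev, abs_of_nonneg (Finset.sum_nonneg fun j _ => by
            split_ifs
            exacts [hf0 _, le_rfl])]
          refine (Finset.sum_le_sum fun j _ => ?_).trans (hfH _ hw)
          split_ifs
          exacts [le_rfl, hf0 _])
      rw [hev, hidx] at hr
      refine ⟨_, ⟨hr.1, hr.2.1, hr.2.2.elim fun t ht => ⟨t, ht.1, ht.2.trans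
        (Nat.mul_le_mul_right _ ?_)⟩⟩, Function.update g (z / n : ℕ)
        (∑ j ∈ Finset.range n, if z / n * n + j < z + 1 then f (z / n * n + j) else 0), ?_, ?_⟩
      · rw [hwt, show (Expr.add (.get a (.div (.var i) (.var 0))) e).weight = e.weight + 5 by
          simp only [Expr.weight]; omega]
        norm_num
      · simp [State.setVar, State.setArr]
      · intro w hwR
        by_cases h : w = z / n
        · subst h
          simp
        · rw [Function.update_of_ne (by exact_mod_cast h), hg w hwR, hstep w hwR, if_neg h,
            add_zero])
  refine ⟨g, ?_, fun w hw => ?_⟩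
  · obtain ⟨h1, h2, t, ht, hle⟩ := hr
    exact ⟨h1, h2, t, ht, hle.trans (Nat.mul_le_mul_right _ (Nat.mul_le_mul_left _
      (by nlinarith [Nat.zero_le e.weight])))⟩
  · rw [hg w hw]
    refine Finset.sum_congr rfl fun j hj => if_pos ?_
    have := Finset.mem_range.1 hj
    calc w * n + j < (w + 1) * n := by linarith [add_mul w 1 n]
      _ ≤ R * n := Nat.mul_le_mul_right _ hw

/-! ### Tests expressed by integer division. -/

/-- The indicator of the value `0`. -/
def Expr.isZero (e : Expr) : Expr := .div (.const 1) (.add (.mul e e) (.const 1))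

/-- The indicator of the negative values. -/
def Expr.isNeg (e : Expr) : Expr := .sub (.const 0) (.div e (.add (.mul e e) (.const 1)))

/-- The remainder of an integer division. -/
def Expr.mod (e f : Expr) : Expr := .sub e (.mul f (.div e f))

/-- The indicator of the integer `0`. -/
def zeroInd (x : ℤ) : ℤ := if x = 0 then 1 else 0

/-- The indicator of the negative integers. -/
def negInd (x : ℤ) : ℤ := if x < 0 then 1 else 0

@[simp] theorem zeroInd_zero : zeroInd 0 = 1 := if_pos rfl

theorem zeroInd_of_ne {x : ℤ} (h : x ≠ 0) : zeroInd x = 0 := if_neg h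

theorem negInd_of_neg {x : ℤ} (h : x < 0) : negInd x = 1 := if_pos h

theorem negInd_of_nonneg {x : ℤ} (h : 0 ≤ x) : negInd x = 0 := if_neg (not_lt.2 h)

theorem zeroInd_eq (x : ℤ) : zeroInd x = 0 ∨ zeroInd x = 1 := by
  unfold zeroInd
  split_ifs <;> simp

-- The quotient `1 / (x * x + 1)` is 1 at `x = 0` and rounds down to 0 elsewhere.
@[simp] theorem Expr.eval_isZero (s : State) (e : Expr) :
    e.isZero.eval s = zeroInd (e.eval s) := by
  simp only [Expr.isZero, Expr.eval, zeroInd]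
  split_ifs with h
  · simp [h]
  · refine Int.ediv_eq_zero_of_lt zero_le_one ?_
    have := mul_self_pos.2 h
    omega

-- Since `|x| ≤ x * x < x * x + 1`, the quotient of `x` by `x * x + 1` rounds down to -1 for
-- negative `x` and to 0 otherwise.
@[simp] theorem Expr.eval_isNeg (s : State) (e : Expr) :
    e.isNeg.eval s = negInd (e.eval s) := by
  simp only [Expr.isNeg, Expr.eval, negInd]
  have hsq : |e.eval s| ≤ e.eval s * e.eval s := by
    rcases eq_or_ne (e.eval s) 0 with h | h
    · simp [h]
    · rw [← abs_mul_abs_self (e.eval s)]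
      nlinarith [Int.one_le_abs h]
  obtain ⟨h1, h2⟩ := abs_le.1 hsq
  split_ifs with h
  · have : e.eval s / (e.eval s * e.eval s + 1) = -1 := by
      rw [Int.ediv_eq_iff_of_pos (by nlinarith)]
      constructor <;> linarith
    rw [this]
    norm_num
  · rw [Int.ediv_eq_zero_of_lt (not_lt.1 h) (by omega), sub_zero]

@[simp] theorem Expr.eval_mod (s : State) (e f : Expr) :
    (e.mod f).eval s = e.eval s % f.eval s := by
  simp only [Expr.mod, Expr.eval, Int.emod_def]

end LogRAM

/-! ## Loops over matrices -/

namespace LogRAM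

theorem flat_lt {n m : ℕ} (i : Fin m) (j : Fin n) : (i : ℕ) * n + j < m * n :=
  calc (i : ℕ) * n + j < (i + 1) * n := by rw [add_mul, one_mul]; omega
    _ ≤ m * n := Nat.mul_le_mul_right _ i.2

theorem exists_eq_flat {n m z : ℕ} (h : z < m * n) : ∃ (i : Fin m) (j : Fin n), z = i * n + j := by
  have hn : 0 < n := Nat.pos_of_ne_zero (by rintro rfl; simp at h)
  exact ⟨⟨z / n, Nat.div_lt_of_lt_mul (by rwa [mul_comm])⟩, ⟨z % n, Nat.mod_lt _ hn⟩, by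
    simpa [mul_comm] using (Nat.div_add_mod z n).symm⟩

@[simp] theorem flat_div {n : ℕ} (x : ℤ) (j : Fin n) : (x * n + j) / (n : ℤ) = x := by
  have hn : (0 : ℤ) < n := by exact_mod_cast j.pos
  rw [add_comm, Int.add_mul_ediv_right _ _ hn.ne',
    Int.ediv_eq_zero_of_lt (by positivity) (by exact_mod_cast j.2), zero_add]

@[simp] theorem flat_mod {n : ℕ} (x : ℤ) (j : Fin n) : (x * n + j) % (n : ℤ) = j := by
  rw [add_comm, Int.add_mul_emod_self_right]
  exact Int.emod_eq_of_lt (by positivity) (by exact_mod_cast j.2)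

theorem flat_inj {n m : ℕ} {i i' : Fin m} {j j' : Fin n}
    (h : (i : ℤ) * n + j = i' * n + j') : i = i' ∧ j = j' := by
  have h1 := congrArg (· / (n : ℤ)) h
  have h2 := congrArg (· % (n : ℤ)) h
  simp only [flat_div, flat_mod] at h1 h2
  exact ⟨Fin.ext (by exact_mod_cast h1), Fin.ext (by exact_mod_cast h2)⟩

/-- The sequence of the entries of a matrix, row by row. -/
def rowMajor {m n : ℕ} (F : Fin m → Fin n → ℤ) (z : ℕ) : ℤ :=
  if h : z < m * n then
    F ⟨z / n, Nat.div_lt_of_lt_mul (by rwa [mul_comm])⟩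
      ⟨z % n, Nat.mod_lt _ (Nat.pos_of_ne_zero (by rintro rfl; simp at h))⟩ else 0

theorem rowMajor_flat {m n : ℕ} (F : Fin m → Fin n → ℤ) (i : Fin m) (j : Fin n) :
    rowMajor F (i * n + j) = F i j := by
  have hn : 0 < n := j.pos
  rw [rowMajor, dif_pos (flat_lt i j)]
  congr 1 <;> ext
  · simp [add_comm _ (j : ℕ), Nat.add_mul_div_right _ _ hn, Nat.div_eq_of_lt j.2]
  · simp [add_comm _ (j : ℕ), Nat.mod_eq_of_lt j.2]

theorem Run.fill_matrix {H m n i y a : ℕ} {e : Expr} {s : State} (F : Fin m → Fin n → ℤ)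
    (hs : s.Within H) (hiy : y ≠ i) (hy : s.var y = (m * n : ℕ))
    (hf : ∀ (p : Fin m) (q : Fin n) (g : ℤ → ℤ), e.eval ⟨Function.update s.var i ((p : ℤ) * n + q),
      Function.update s.arr a g⟩ = F p q ∧ |F p q| ≤ H) :
    ∃ (g : ℤ → ℤ) (v : ℤ), Run H (LogRAM.fill i y a e) s
      ⟨Function.update s.var i v, Function.update s.arr a g⟩
      ((m * n + 1) * (e.weight ^ 2 + 40)) ∧
      ∀ (p : Fin m) (q : Fin n), g ((p : ℤ) * n + q) = F p q := by
  obtain ⟨g, hr, hg⟩ := Run.fill (a := a) (rowMajor F) hs hiy hy (by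
    intro z hz g
    obtain ⟨p, q, rfl⟩ := exists_eq_flat hz
    rw [rowMajor_flat]
    exact_mod_cast hf p q g)
  refine ⟨g, _, hr, fun p q => ?_⟩
  have := hg _ (flat_lt p q)
  rw [rowMajor_flat] at this
  exact_mod_cast this

theorem Run.rowSum_matrix {H m n i y a : ℕ} {e : Expr} {s : State} (F : Fin m → Fin n → ℤ)
    (hs : s.Within H) (hiy : y ≠ i) (hi0 : i ≠ 0) (hy : s.var y = (m * n : ℕ)) (hn : s.var 0 = n)
    (ha : ∀ w < m, s.arr a (w : ℕ) = 0) (hF0 : ∀ p q, 0 ≤ F p q)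
    (hFH : ∀ p, ∑ q, F p q ≤ H)
    (hf : ∀ (p : Fin m) (q : Fin n) (g : ℤ → ℤ), e.eval ⟨Function.update s.var i ((p : ℤ) * n + q),
      Function.update s.arr a g⟩ = F p q) :
    ∃ (g : ℤ → ℤ) (v : ℤ), Run H (LogRAM.rowSum i y a e) s
      ⟨Function.update s.var i v, Function.update s.arr a g⟩
      ((m * n + 1) * ((e.weight + 6) ^ 2 + 40)) ∧ ∀ p : Fin m, g (p : ℕ) = ∑ q, F p q := by
  have hsum : ∀ p : Fin m, ∑ j ∈ Finset.range n, rowMajor F (p * n + j) = ∑ q, F p q := by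
    intro p
    rw [← Fin.sum_univ_eq_sum_range (fun j => rowMajor F (p * n + j))]
    exact Finset.sum_congr rfl fun q _ => rowMajor_flat F p q
  obtain ⟨g, hr, hg⟩ := Run.rowSum (a := a) (rowMajor F) hs hiy hi0 hy hn ha
    (by
      intro z
      unfold rowMajor
      split_ifs
      exacts [hF0 _ _, le_rfl])
    (fun w hw => (hsum ⟨w, hw⟩).trans_le (hFH _)) (by
      intro z hz g
      obtain ⟨p, q, rfl⟩ := exists_eq_flat hz
      rw [rowMajor_flat]
      exact_mod_cast hf p q g)
  exact ⟨g, _, hr, fun p => (hg p p.2).trans (hsum p)⟩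

theorem Run.mono {H : ℕ} {p : Prog} {s s' : State} {k l : ℕ} (h : Run H p s s' k) (hkl : k ≤ l) :
    Run H p s s' l :=
  ⟨h.1, h.2.1, h.2.2.elim fun t ht => ⟨t, ht.1, ht.2.trans (Nat.mul_le_mul_right _ hkl)⟩⟩

theorem Run.seq_mul {H : ℕ} {p q : Prog} {s s₁ s₂ : State} {c d m : ℕ}
    (h₁ : Run H p s s₁ (c * m)) (h₂ : Run H q s₁ s₂ (d * m)) :
    Run H (.seq p q) s s₂ ((c + d) * m) :=
  (h₁.seq h₂).mono (add_mul c d m).ge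

theorem le_mul_cube (n x : ℕ) : x ≤ x * (n + 1) ^ 3 :=
  Nat.le_mul_of_pos_right _ (Nat.pow_pos (Nat.succ_pos n))

theorem cube_mul_le_mul_cube (n x : ℕ) : (n * n * n + 1) * x ≤ x * (n + 1) ^ 3 := by
  rw [mul_comm]
  exact Nat.mul_le_mul_left _ (by nlinarith [Nat.zero_le n, Nat.zero_le (n * n)])

theorem sq_mul_le_mul_cube (n x : ℕ) : (n * n + 1) * x ≤ x * (n + 1) ^ 3 := by
  rw [mul_comm]
  exact Nat.mul_le_mul_left _ (by nlinarith [Nat.zero_le n, Nat.zero_le (n * n * n)])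

theorem one_mul_le_mul_cube (n x : ℕ) : (1 * n + 1) * x ≤ x * (n + 1) ^ 3 := by
  rw [mul_comm]
  exact Nat.mul_le_mul_left _
    (by nlinarith [Nat.zero_le n, Nat.zero_le (n * n), Nat.zero_le (n * n * n)])

/-! ## Clearing denominators -/

/-- Multiply the product of the denominators by the next one. -/
def denExpr : Expr := .mul (.var 3) (.get 2 (.var 9))

/-- The entry of the integer matrix. -/
def entryExpr : Expr := .mul (.get 1 (.var 9)) (.div (.var 3) (.get 2 (.var 9)))

/-- The absolute value of the entry of the integer matrix. -/
def absExpr : Expr :=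
  .mul (.get 5 (.var 9)) (.sub (.const 1) (.mul (.const 2) (.isNeg (.get 5 (.var 9)))))

/-- The maximum of variable `4` and the absolute value of the entry. -/
def maxExpr : Expr :=
  .add (.var 4) (.mul (.isNeg (.sub (.var 4) absExpr)) (.sub absExpr (.var 4)))

/-- Compute an integer multiple of the input matrix, its largest entry, and the initial tableau. -/
def scaleProg : Prog :=
  .seq (.assign 1 (.mul (.var 0) (.var 0))) <|
  .seq (.assign 2 (.mul (.var 1) (.var 0))) <|
  .seq (.assign 3 (.const 1)) <|
  .seq (fold 9 1 3 denExpr) <|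
  .seq (fill 9 1 5 entryExpr) <|
  .seq (fold 9 1 4 maxExpr) <|
  .seq (fill 9 1 6 (.get 5 (.var 9))) (.assign 5 (.const 1))

/-- As in all the `run_` statements, `c` is chosen before the input, so the time bound is uniform.
The last two clauses say that `C` is the exact maximum of the absolute values. The tableau starts as
the matrix itself, for the basis of unit vectors. -/
theorem run_scaleProg : ∃ c : ℕ, ∀ {n H : ℕ} {s : State} {num : Fin n → Fin n → ℤ}
    {den : Fin n → Fin n → ℕ}, s.Within H → s.var 0 = n → s.var 4 = 0 →
    (∀ i j : Fin n, s.arr 1 ((i : ℤ) * n + j) = num i j) →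
    (∀ i j : Fin n, s.arr 2 ((i : ℤ) * n + j) = den i j) →
    (∀ i j, 0 < den i j) → n ^ 3 ≤ H → 1 ≤ H →
    (∏ i, ∏ j, den i j) ≤ H →
    (∀ i j, |num i j * ((∏ i, ∏ j, den i j) / den i j : ℕ)| ≤ H) →
    ∃ (s' : State) (C : ℕ), Run H scaleProg s s' (c * (n + 1) ^ 3) ∧
      s'.var 1 = (n * n : ℕ) ∧ s'.var 2 = (n * n * n : ℕ) ∧
      s'.var 3 = (∏ i, ∏ j, den i j : ℕ) ∧ s'.var 4 = C ∧ s'.var 5 = 1 ∧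
      (∀ i j : Fin n, s'.arr 5 ((i : ℤ) * n + j) =
        num i j * ((∏ i, ∏ j, den i j) / den i j : ℕ)) ∧
      (∀ i j : Fin n, s'.arr 6 ((i : ℤ) * n + j) =
        num i j * ((∏ i, ∏ j, den i j) / den i j : ℕ)) ∧
      (∀ i j, |num i j * ((∏ i, ∏ j, den i j) / den i j : ℕ)| ≤ C) ∧
      (C = 0 ∨ ∃ i j, |num i j * ((∏ i, ∏ j, den i j) / den i j : ℕ)| = C) := by
  refine ⟨(Expr.weight (.mul (.var 0) (.var 0))) ^ 2 + 1 +
    ((Expr.weight (.mul (.var 1) (.var 0))) ^ 2 + 1 +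
    ((Expr.weight (.const 1)) ^ 2 + 1 + ((denExpr.weight ^ 2 + 40) + ((entryExpr.weight ^ 2 + 40) +
    ((maxExpr.weight ^ 2 + 40) + ((Expr.weight (.get 5 (.var 9)) ^ 2 + 40) +
    ((Expr.weight (.const 1)) ^ 2 + 1))))))), ?_⟩
  intro n H s num den hs h0 h4 hnum hden hpos hn3 hH1 hL hN
  set L := ∏ i, ∏ j, den i j with hLdef
  set N : Fin n → Fin n → ℤ := fun i j => num i j * (L / den i j : ℕ) with hNdef
  have hnn : n * n ≤ n ^ 3 := by
    rcases Nat.eq_zero_or_pos n with rfl | h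
    · simp
    · nlinarith [Nat.mul_le_mul_left (n * n) h]
  -- sizes
  have r1 := Run.assign hs 1 (.mul (.var 0) (.var 0)) (by
    simp only [Expr.eval, h0]
    rw [← Nat.cast_mul, Nat.abs_cast]
    exact_mod_cast hnn.trans hn3)
  set s1 := s.setVar 1 (Expr.eval s (.mul (.var 0) (.var 0))) with hs1
  have v11 : s1.var 1 = (n * n : ℕ) := by simp [hs1, State.setVar, Expr.eval, h0]
  have v10 : s1.var 0 = n := by simp [hs1, State.setVar, h0]
  have r2 := Run.assign r1.within 2 (.mul (.var 1) (.var 0)) (by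
    simp only [Expr.eval, v11, v10]
    rw [← Nat.cast_mul, Nat.abs_cast]
    exact_mod_cast (by rw [← pow_two, ← pow_succ]; exact hn3 : n * n * n ≤ H))
  set s2 := s1.setVar 2 (Expr.eval s1 (.mul (.var 1) (.var 0))) with hs2
  have v22 : s2.var 2 = (n * n * n : ℕ) := by simp [hs2, State.setVar, Expr.eval, v11, v10]
  have v21 : s2.var 1 = (n * n : ℕ) := by rw [← v11]; simp [hs2, State.setVar]
  have v20 : s2.var 0 = n := by simp [hs2, State.setVar, v10]
  have r3 := Run.assign r2.within 3 (.const 1) (by simpa [Expr.eval] using hH1)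
  set s3 := s2.setVar 3 (Expr.eval s2 (.const 1)) with hs3
  have v33 : s3.var 3 = 1 := by simp [hs3, State.setVar, Expr.eval]
  have v31 : s3.var 1 = (n * n : ℕ) := by rw [← v21]; simp [hs3, State.setVar]
  have a3 : s3.arr = s.arr := rfl
  -- product of the denominators
  set d : ℕ → ℕ := fun z => (s.arr 2 z).toNat with hd
  have hdf : ∀ i j : Fin n, d (i * n + j) = den i j := by
    intro i j
    simp only [hd]
    push_cast
    rw [hden i j]
    simp
  have hdarr : ∀ z < n * n, s.arr 2 z = d z := by
    intro z hz
    obtain ⟨i, j, rfl⟩ := exists_eq_flat hz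
    rw [hdf]
    push_cast
    rw [hden i j]
  have hd1 : ∀ z < n * n, 1 ≤ d z := by
    intro z hz
    obtain ⟨i, j, rfl⟩ := exists_eq_flat hz
    rw [hdf]
    exact hpos i j
  have hprod : ∏ z ∈ Finset.range (n * n), d z = L := by
    rw [← Fin.prod_univ_eq_prod_range, ← finProdFinEquiv.prod_comp, Fintype.prod_prod_type, hLdef]
    refine Finset.prod_congr rfl fun i _ => Finset.prod_congr rfl fun j _ => ?_
    rw [← hdf i j]
    congr 1
    simp [finProdFinEquiv]
    ring
  have r4 := Run.fold (i := 9) (y := 1) (v := 3) (e := denExpr) (N := n * n)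
    (fun z => ((∏ w ∈ Finset.range z, d w : ℕ) : ℤ)) r3.within (by decide) (by decide) (by decide)
    v31 (by simp [v33]) (by
      intro z hz
      constructor
      · rw [Finset.prod_range_succ]
        simp [denExpr, Expr.eval, a3, hdarr z hz]
      · rw [Nat.abs_cast]
        refine Nat.cast_le.2 (le_trans ?_ (hprod.trans_le hL))
        refine Finset.prod_le_prod_of_subset_of_one_le' (Finset.range_subset_range.2 hz) ?_
        exact fun w hw _ => hd1 w (Finset.mem_range.1 hw))
  rw [hprod] at r4
  set s4 : State := ⟨Function.update (Function.update s3.var 3 (L : ℤ)) 9 ((n * n : ℕ) : ℤ), s3.arr⟩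
    with hs4
  have v43 : s4.var 3 = L := by simp [hs4]
  have v41 : s4.var 1 = (n * n : ℕ) := by rw [← v31]; simp [hs4]
  have a4 : s4.arr = s.arr := rfl
  -- the integer matrix
  obtain ⟨g5, w5, r5, hg5⟩ := Run.fill_matrix (i := 9) (y := 1) (a := 5) (e := entryExpr) N
    r4.within (by decide) v41 (by
      intro i j g
      refine ⟨?_, hN i j⟩
      simp [entryExpr, Expr.eval, a4, hnum, hden, v43, hNdef])
  set s5 : State := ⟨Function.update s4.var 9 w5, Function.update s4.arr 5 g5⟩ with hs5
  have v51 : s5.var 1 = (n * n : ℕ) := by rw [← v41]; simp [hs5]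
  have a55 : ∀ i j : Fin n, s5.arr 5 ((i : ℤ) * n + j) = N i j := by simpa [hs5] using hg5
  -- the largest entry
  set e : ℕ → ℕ := fun z => (s5.arr 5 z).natAbs with he
  have hef : ∀ i j : Fin n, e (i * n + j) = (N i j).natAbs := by
    intro i j
    simp only [he]
    push_cast
    rw [a55 i j]
  have hsupH : ∀ z ≤ n * n, (Finset.range z).sup e ≤ H := by
    intro z hz
    refine Finset.sup_le fun w hw => ?_
    obtain ⟨i, j, rfl⟩ := exists_eq_flat ((Finset.mem_range.1 hw).trans_le hz)
    have := hN i j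
    rw [hef]
    rw [Int.abs_eq_natAbs] at this
    exact_mod_cast this
  have v54 : s5.var 4 = 0 := by
    rw [r5.var_eq 4 (by decide), r4.var_eq 4 (by decide), r3.var_eq 4 (by decide),
      r2.var_eq 4 (by decide), r1.var_eq 4 (by decide), h4]
  have habs : ∀ s : State, absExpr.eval s = |s.arr 5 (s.var 9)| := by
    intro s
    simp only [absExpr, Expr.eval, Expr.eval_isNeg]
    rcases lt_or_ge (s.arr 5 (s.var 9)) 0 with h | h
    · rw [negInd_of_neg h, abs_of_neg h]
      ring
    · rw [negInd_of_nonneg h, abs_of_nonneg h]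
      ring
  have r6 := Run.fold (i := 9) (y := 1) (v := 4) (e := maxExpr) (N := n * n)
    (fun z => (((Finset.range z).sup e : ℕ) : ℤ)) r5.within (by decide) (by decide) (by decide)
    v51 (by simp [v54]) (by
      intro z hz
      constructor
      · rw [Finset.range_add_one, Finset.sup_insert]
        have hez : |s5.arr 5 z| = (e z : ℤ) := by simp [he]
        have hev : maxExpr.eval ⟨Function.update (Function.update s5.var 4
            (((Finset.range z).sup e : ℕ) : ℤ)) 9 z, s5.arr⟩ = (((Finset.range z).sup e : ℕ) : ℤ) +
            negInd ((((Finset.range z).sup e : ℕ) : ℤ) - e z) *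
              (e z - (((Finset.range z).sup e : ℕ) : ℤ)) := by
          simp [maxExpr, Expr.eval, habs, hez]
        rw [hev, Nat.cast_max]
        rcases lt_or_ge ((((Finset.range z).sup e : ℕ) : ℤ) - e z) 0 with h | h
        · rw [negInd_of_neg h, max_eq_left (by omega)]
          ring
        · rw [negInd_of_nonneg h, max_eq_right (by omega)]
          ring
      · rw [Nat.abs_cast]
        exact Nat.cast_le.2 (hsupH _ hz))
  set C := (Finset.range (n * n)).sup e with hC
  set s6 : State := ⟨Function.update (Function.update s5.var 4 (C : ℤ)) 9 ((n * n : ℕ) : ℤ), s5.arr⟩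
    with hs6
  have v61 : s6.var 1 = (n * n : ℕ) := by rw [← v51]; simp [hs6]
  obtain ⟨g7, w7, r7, hg7⟩ := Run.fill_matrix (i := 9) (y := 1) (a := 6)
    (e := .get 5 (.var 9)) N r6.within (by decide) v61 (by
      intro i j g
      refine ⟨?_, hN i j⟩
      simp [Expr.eval, hs6, a55])
  have r8 := Run.assign r7.within 5 (.const 1) (by simpa [Expr.eval] using hH1)
  have rr := (r1.mono (le_mul_cube n _)).seq_mul <| (r2.mono (le_mul_cube n _)).seq_mul <|
    (r3.mono (le_mul_cube n _)).seq_mul <| (r4.mono (sq_mul_le_mul_cube n _)).seq_mul <|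
    (r5.mono (sq_mul_le_mul_cube n _)).seq_mul <| (r6.mono (sq_mul_le_mul_cube n _)).seq_mul <|
    (r7.mono (sq_mul_le_mul_cube n _)).seq_mul <| r8.mono (le_mul_cube n _)
  refine ⟨_, C, rr, ?_, ?_, ?_, ?_, ?_, ?_, ?_, ?_, ?_⟩
  · simp [State.setVar, v61]
  · simp [State.setVar, hs6, hs5, hs4, hs3, v22]
  · simp [State.setVar, hs6, hs5, v43]
  · simp [State.setVar, hs6]
  · simp [State.setVar, Expr.eval]
  · intro i j
    change s5.arr 5 _ = N i j
    exact a55 i j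
  · intro i j
    change Function.update s6.arr 6 g7 6 _ = N i j
    simpa using hg7 i j
  · intro i j
    have h1 : e (i * n + j) ≤ C := Finset.le_sup (Finset.mem_range.2 (flat_lt i j))
    rw [hef] at h1
    change |N i j| ≤ C
    rw [Int.abs_eq_natAbs]
    exact_mod_cast h1
  · rcases (Finset.range (n * n)).eq_empty_or_nonempty with h | h
    · exact .inl (by rw [hC, h]; rfl)
    · obtain ⟨z, hz, hzC⟩ := Finset.exists_mem_eq_sup _ h e
      obtain ⟨i, j, rfl⟩ := exists_eq_flat (Finset.mem_range.1 hz)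
      refine .inr ⟨i, j, ?_⟩
      change |N i j| = C
      rw [hC, hzC, hef, Int.abs_eq_natAbs]

end LogRAM

/-! ## The pivoting loop -/

namespace LogRAM

section

variable {n H : ℕ} {N : Matrix (Fin n) (Fin n) ℤ} {σ : Fin n → Option (Fin n)} {s s' : State}

/-- The integer that stores an entry of a basis. -/
def basisCode (o : Option (Fin n)) : ℤ := o.elim 0 fun p => (p : ℤ) + 1

@[simp] theorem basisCode_none : basisCode (none : Option (Fin n)) = 0 := rfl

@[simp] theorem basisCode_some (p : Fin n) : basisCode (some p) = (p : ℤ) + 1 := rfl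

theorem zeroInd_basisCode (o : Option (Fin n)) :
    zeroInd (basisCode o) = if o.isSome then 0 else 1 := by
  cases o with
  | none => simp
  | some p =>
    rw [zeroInd_of_ne]
    · simp
    · simp only [basisCode_some]
      positivity

/-- The memory holds the basis `σ`, its determinant and its tableau. -/
structure HasBasis (N : Matrix (Fin n) (Fin n) ℤ) (σ : Fin n → Option (Fin n)) (s : State) :
    Prop where
  basis : ∀ q : Fin n, s.arr 8 (q : ℕ) = basisCode (σ q)
  det : s.var 5 = (basisMatrix N σ).det
  tab : ∀ i j : Fin n, s.arr 6 ((i : ℤ) * n + j) = tableau N σ i j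

theorem HasBasis.congr (h : HasBasis N σ s) (h8 : s'.arr 8 = s.arr 8) (h5 : s'.var 5 = s.var 5)
    (h6 : s'.arr 6 = s.arr 6) : HasBasis N σ s' :=
  ⟨fun q => by rw [h8, h.basis], by rw [h5, h.det], fun i j => by rw [h6, h.tab]⟩

/-- Row `p` should enter the basis at position `q`. -/
def Improvable (N : Matrix (Fin n) (Fin n) ℤ) (σ : Fin n → Option (Fin n)) (p q : Fin n) : Prop :=
  (σ q = none ∧ tableau N σ p q ≠ 0) ∨
    (σ q ≠ none ∧ 9 * (basisMatrix N σ).det ^ 2 < 4 * tableau N σ p q ^ 2)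

theorem Improvable.tableau_ne_zero {p q : Fin n} (h : Improvable N σ p q) :
    tableau N σ p q ≠ 0 := by
  rcases h with h | ⟨-, h⟩
  · exact h.2
  · rintro h0
    rw [h0] at h
    nlinarith [sq_nonneg (basisMatrix N σ).det]

end

/-- The row of the current index. -/
def rowExpr : Expr := .div (.var 9) (.var 0)

/-- The column of the current index. -/
def colExpr : Expr := .mod (.var 9) (.var 0)

/-- The indicator of the positions at which a pivot improves the basis. -/
def improvableExpr : Expr :=
  .add (.mul (.isZero (.get 8 colExpr)) (.sub (.const 1) (.isZero (.get 6 (.var 9)))))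
    (.mul (.sub (.const 1) (.isZero (.get 8 colExpr)))
      (.isNeg (.sub (.mul (.const 9) (.mul (.var 5) (.var 5)))
        (.mul (.const 4) (.mul (.get 6 (.var 9)) (.get 6 (.var 9)))))))

/-- Keep the last index at which a pivot improves the basis. -/
def lastExpr : Expr :=
  .add (.var 6) (.mul improvableExpr (.sub (.add (.var 9) (.const 1)) (.var 6)))

/-- Look for an improving pivot; variable `6` is its index plus one, or zero. -/
def findProg : Prog := .seq (.assign 6 (.const 0)) (fold 9 1 6 lastExpr)

theorem run_findProg : ∃ c : ℕ, ∀ {n H : ℕ} {N : Matrix (Fin n) (Fin n) ℤ}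
    {σ : Fin n → Option (Fin n)} {s : State}, s.Within H → s.var 0 = n →
    s.var 1 = (n * n : ℕ) → HasBasis N σ s →
    ∃ s', Run H findProg s s' (c * (n + 1) ^ 3) ∧
      ((s'.var 6 = 0 ∧ ∀ p q, ¬ Improvable N σ p q) ∨
        ∃ p q : Fin n, Improvable N σ p q ∧ s'.var 6 = (p : ℤ) * n + q + 1) := by
  classical
  refine ⟨(Expr.weight (.const 0)) ^ 2 + 1 + (lastExpr.weight ^ 2 + 40),
    fun {n H N σ s} hs h0 h1 hb => ?_⟩
  have hnH : n * n ≤ H := by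
    have := hs.1 1
    rw [h1, Nat.abs_cast] at this
    exact_mod_cast this
  have r1 := Run.assign hs 6 (.const 0) (by simp [Expr.eval])
  set s1 := s.setVar 6 (Expr.eval s (.const 0)) with hs1
  have v10 : s1.var 0 = n := by simp [hs1, State.setVar, h0]
  have v11 : s1.var 1 = (n * n : ℕ) := by rw [← h1]; simp [hs1, State.setVar]
  have v16 : s1.var 6 = 0 := by simp [hs1, State.setVar, Expr.eval]
  have v15 : s1.var 5 = s.var 5 := by simp [hs1, State.setVar]
  have a1 : s1.arr = s.arr := rfl
  let B : ℕ → Prop := fun z => ∃ p q : Fin n, z = p * n + q ∧ Improvable N σ p q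
  -- The shift by one frees the value 0 for "no improving pivot", which is also the value that stops
  -- the pivoting loop.
  obtain ⟨f, hf0, hfs⟩ : ∃ f : ℕ → ℕ, f 0 = 0 ∧ ∀ z, f (z + 1) = if B z then z + 1 else f z :=
    ⟨fun z => Nat.rec 0 (fun z acc => if B z then z + 1 else acc) z, rfl, fun _ => rfl⟩
  have hfle : ∀ z, f z ≤ z := by
    intro z
    induction z with
    | zero => exact hf0.le
    | succ z ih =>
      rw [hfs]
      split_ifs <;> omega
  have hfB : ∀ z, (f z = 0 ∧ ∀ w < z, ¬ B w) ∨ ∃ w < z, B w ∧ f z = w + 1 := by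
    intro z
    induction z with
    | zero => exact .inl ⟨hf0, by simp⟩
    | succ z ih =>
      rw [hfs]
      by_cases h : B z
      · exact .inr ⟨z, by omega, h, by simp [h]⟩
      · rw [if_neg h]
        rcases ih with ⟨h1, h2⟩ | ⟨w, hw, h1, h2⟩
        · refine .inl ⟨h1, fun w hw => ?_⟩
          rcases Nat.lt_succ_iff_lt_or_eq.1 hw with h3 | rfl
          exacts [h2 w h3, h]
        · exact .inr ⟨w, by omega, h1, h2⟩
  have r2 := Run.fold (i := 9) (y := 1) (v := 6) (e := lastExpr) (N := n * n)
    (fun z => ((f z : ℕ) : ℤ)) r1.within (by decide) (by decide) (by decide) v11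
    (by rw [v16, hf0]; rfl) (by
      intro z hz
      refine ⟨?_, ?_⟩
      · obtain ⟨p, q, rfl⟩ := exists_eq_flat hz
        have hB : B (p * n + q) ↔ Improvable N σ p q := by
          constructor
          · rintro ⟨p', q', h, h'⟩
            obtain ⟨rfl, rfl⟩ := flat_inj (by exact_mod_cast h)
            exact h'
          · exact fun h => ⟨p, q, rfl, h⟩
        have hev : improvableExpr.eval ⟨Function.update (Function.update s1.var 6
            (f (p * n + q) : ℤ)) 9 ((p * n + q : ℕ) : ℤ), s1.arr⟩ =
            if B (p * n + q) then 1 else 0 := by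
          have hq8 := hb.basis q
          simp only [improvableExpr, colExpr, Expr.eval, Expr.eval_isZero, Expr.eval_isNeg,
            Expr.eval_mod]
          simp only [Function.update_apply, if_true, reduceIte,
            Nat.reduceEqDiff, OfNat.zero_ne_ofNat, v10, a1, v15, hb.det, Nat.cast_add,
            Nat.cast_mul, flat_mod, hb.tab, hq8, zeroInd_basisCode, hB]
          unfold Improvable
          cases h : σ q with
          | none =>
            by_cases hT : tableau N σ p q = 0
            · simp [hT]
            · simp [hT, zeroInd_of_ne hT]
          | some k =>
            by_cases hT : 9 * (basisMatrix N σ).det ^ 2 < 4 * tableau N σ p q ^ 2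
            · simp [hT, negInd_of_neg
                (show 9 * ((basisMatrix N σ).det * (basisMatrix N σ).det) -
                  4 * (tableau N σ p q * tableau N σ p q) < 0 by nlinarith)]
            · simp [hT, negInd_of_nonneg
                (show 0 ≤ 9 * ((basisMatrix N σ).det * (basisMatrix N σ).det) -
                  4 * (tableau N σ p q * tableau N σ p q) by nlinarith)]
        rw [hfs]
        simp only [lastExpr, Expr.eval, hev]
        split_ifs
        · simp
        · simp
      · rw [Nat.abs_cast]
        exact_mod_cast (hfle _).trans ((Nat.succ_le_of_lt hz).trans hnH))
  refine ⟨_, (r1.mono (le_mul_cube n _)).seq_mul (r2.mono (sq_mul_le_mul_cube n _)), ?_⟩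
  have hv : (Function.update (Function.update s1.var 6 (f (n * n) : ℤ)) 9
      ((n * n : ℕ) : ℤ)) 6 = f (n * n) := by simp
  simp only [hv]
  rcases hfB (n * n) with ⟨h2, h3⟩ | ⟨w, hw, ⟨p, q, rfl, hI⟩, h3⟩
  · exact .inl ⟨by rw [h2]; rfl, fun p q hI => h3 _ (flat_lt p q) ⟨p, q, rfl, hI⟩⟩
  · exact .inr ⟨p, q, hI, by rw [h3]; push_cast; rfl⟩

/-- The index of the pivot. -/
def pivExpr : Expr := .sub (.var 6) (.const 1)

/-- The column of the pivot. -/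
def pivColExpr : Expr := .mod pivExpr (.var 0)

/-- The row of the pivot. -/
def pivRowExpr : Expr := .div pivExpr (.var 0)

/-- The entry of the new tableau. -/
def updateExpr : Expr :=
  .add (.mul (.isZero (.sub colExpr pivColExpr)) (.get 6 (.var 9)))
    (.mul (.sub (.const 1) (.isZero (.sub colExpr pivColExpr)))
      (.div (.sub (.mul (.get 6 (.var 9)) (.get 6 pivExpr))
        (.mul (.get 6 (.add (.mul rowExpr (.var 0)) pivColExpr))
          (.get 6 (.add (.mul pivRowExpr (.var 0)) colExpr)))) (.var 5)))

/-- Perform the pivot. -/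
def pivotProg : Prog :=
  .seq (fill 9 1 7 updateExpr) <|
  .seq (.assign 5 (.get 6 pivExpr)) <|
  .seq (fill 9 1 6 (.get 7 (.var 9))) (.put 8 pivColExpr (.add pivRowExpr (.const 1)))

/-- The new tableau is built in a separate array because each entry needs old entries and the old
determinant. The old pivot entry then becomes the new determinant. -/
theorem run_pivotProg : ∃ c : ℕ, ∀ {n H : ℕ} {N : Matrix (Fin n) (Fin n) ℤ}
    {σ : Fin n → Option (Fin n)} {s : State} {p q : Fin n}, s.Within H → s.var 0 = n →
    s.var 1 = (n * n : ℕ) → HasBasis N σ s → s.var 6 = (p : ℤ) * n + q + 1 →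
    tableau N σ p q ≠ 0 → (basisMatrix N σ).det ≠ 0 →
    (∀ σ p q, |tableau N σ p q| ≤ H) →
    ∃ s', Run H pivotProg s s' (c * (n + 1) ^ 3) ∧
      HasBasis N (Function.update σ q (some p)) s' := by
  refine ⟨updateExpr.weight ^ 2 + 40 + (Expr.weight (.get 6 pivExpr) ^ 2 + 1 +
    (Expr.weight (.get 7 (.var 9)) ^ 2 + 40 + (pivColExpr.weight ^ 2 +
      Expr.weight (.add pivRowExpr (.const 1)) ^ 2 + 1))), fun {n H N σ s p q} hs h0 h1 hb h6 hT hD hH => ?_⟩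
  have hnH : n ≤ H := by
    have := hs.1 0
    rw [h0, Nat.abs_cast] at this
    exact_mod_cast this
  obtain ⟨g1, w1, r1, hg1⟩ := Run.fill_matrix (i := 9) (y := 1) (a := 7) (e := updateExpr)
    (fun i j => tableau N (Function.update σ q (some p)) i j) hs (by decide) h1 (by
      intro i j g
      refine ⟨?_, hH _ _ _⟩
      simp only [updateExpr, colExpr, pivColExpr, rowExpr, pivRowExpr, pivExpr, Expr.eval,
        Expr.eval_isZero, Expr.eval_mod]
      simp only [Function.update_apply, if_true, reduceIte,
        Nat.reduceEqDiff, OfNat.zero_ne_ofNat, h0, h6, hb.det, flat_mod, flat_div, hb.tab,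
        add_sub_cancel_right]
      by_cases hj : j = q
      · subst hj
        simp [tableau_update_self]
      · have hne : ((j : ℕ) : ℤ) - ((q : ℕ) : ℤ) ≠ 0 := by
          intro h
          exact hj (Fin.ext (by omega))
        rw [zeroInd_of_ne hne, ← det_mul_tableau_update N σ p q hT i j hj,
          Int.mul_ediv_cancel_left _ hD]
        ring)
  set s1 : State := ⟨Function.update s.var 9 w1, Function.update s.arr 7 g1⟩ with hs1
  have v10 : s1.var 0 = n := by simp [hs1, h0]
  have v11 : s1.var 1 = (n * n : ℕ) := by rw [← h1]; simp [hs1]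
  have v16 : s1.var 6 = (p : ℤ) * n + q + 1 := by rw [← h6]; simp [hs1]
  have a16 : s1.arr 6 = s.arr 6 := by simp [hs1]
  have a18 : s1.arr 8 = s.arr 8 := by simp [hs1]
  have e2 : (Expr.get 6 pivExpr).eval s1 =
      (basisMatrix N (Function.update σ q (some p))).det := by
    simp only [Expr.eval, pivExpr, v16, add_sub_cancel_right, a16, hb.tab, tableau_apply]
  have r2 := Run.assign r1.within 5 (.get 6 pivExpr) (by
    rw [e2, ← tableau_apply]
    exact hH _ _ _)
  rw [e2] at r2
  set s2 := s1.setVar 5 (basisMatrix N (Function.update σ q (some p))).det with hs2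
  have v20 : s2.var 0 = n := by simp [hs2, State.setVar, v10]
  have v21 : s2.var 1 = (n * n : ℕ) := by rw [← v11]; simp [hs2, State.setVar]
  have v26 : s2.var 6 = (p : ℤ) * n + q + 1 := by rw [← v16]; simp [hs2, State.setVar]
  have v25 : s2.var 5 = (basisMatrix N (Function.update σ q (some p))).det := by
    simp [hs2, State.setVar]
  have a2 : s2.arr = s1.arr := rfl
  obtain ⟨g3, w3, r3, hg3⟩ := Run.fill_matrix (i := 9) (y := 1) (a := 6)
    (e := .get 7 (.var 9)) (fun i j => tableau N (Function.update σ q (some p)) i j)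
    r2.within (by decide) v21 (by
      intro i j g
      refine ⟨?_, hH _ _ _⟩
      simp [Expr.eval, a2, hs1, hg1])
  set s3 : State := ⟨Function.update s2.var 9 w3, Function.update s2.arr 6 g3⟩ with hs3
  have v30 : s3.var 0 = n := by simp [hs3, v20]
  have v36 : s3.var 6 = (p : ℤ) * n + q + 1 := by rw [← v26]; simp [hs3]
  have a38 : s3.arr 8 = s.arr 8 := by simp [hs3, a2, a18]
  have e4 : (Expr.add pivRowExpr (.const 1)).eval s3 = (p : ℤ) + 1 := by
    simp [Expr.eval, pivRowExpr, pivExpr, v30, v36]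
  have i4 : pivColExpr.eval s3 = (q : ℕ) := by
    simp only [Expr.eval, pivColExpr, pivExpr, Expr.eval_mod, v30, v36, add_sub_cancel_right,
      flat_mod]
  have r4 := Run.put r3.within 8 pivColExpr (.add pivRowExpr (.const 1)) (by
    rw [e4, abs_of_nonneg (by positivity)]
    exact_mod_cast p.2.trans_le hnH)
  rw [e4, i4] at r4
  refine ⟨_, (r1.mono (sq_mul_le_mul_cube n _)).seq_mul <| (r2.mono (le_mul_cube n _)).seq_mul <|
    (r3.mono (sq_mul_le_mul_cube n _)).seq_mul <| r4.mono (le_mul_cube n _), ?_, ?_, ?_⟩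
  · intro k
    by_cases hk : k = q
    · subst hk
      simp [State.setArr]
    · have hk' : ((k : ℕ) : ℤ) ≠ (q : ℕ) := by
        intro h
        exact hk (Fin.ext (by exact_mod_cast h))
      simp [State.setArr, hk, hk', a38, hb.basis]
  · simp [State.setArr, hs3, v25]
  · intro i j
    simp [State.setArr, hs3, hg3]

/-- Pivot until no pivot improves the basis. -/
def pivotLoop : Prog := .seq findProg (.while (.var 6) (.seq pivotProg findProg))

/-- The number of pivots that may still follow. -/
def pivotMeasure {n : ℕ} (N : Matrix (Fin n) (Fin n) ℤ) (σ : Fin n → Option (Fin n)) (l : ℕ) : ℕ :=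
  (n - (rowPositions σ).card) * (l + 1) + (l - Nat.log 2 ((basisMatrix N σ).det.natAbs ^ 2))

/-- A lexicographic order in one number. Replacing a unit vector lowers the first summand by `l +
1`, which outweighs any loss of determinant since the second is at most `l`. Replacing a matrix row
multiplies the squared determinant by more than 9/4, so its binary logarithm grows by at least one.
-/
theorem pivotMeasure_update_lt {n l : ℕ} {N : Matrix (Fin n) (Fin n) ℤ}
    {σ : Fin n → Option (Fin n)} {p q : Fin n}
    (hl : ∀ τ, Nat.log 2 ((basisMatrix N τ).det.natAbs ^ 2) ≤ l)
    (hdet : (basisMatrix N σ).det ≠ 0) (h : Improvable N σ p q) :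
    pivotMeasure N (Function.update σ q (some p)) l < pivotMeasure N σ l := by
  unfold pivotMeasure
  rcases h with ⟨hq, -⟩ | ⟨hq, hT⟩
  · have hc := card_rowPositions_update_of_none hq p
    have hle : (rowPositions (Function.update σ q (some p))).card ≤ n :=
      (Finset.card_le_univ _).trans (by simp)
    rw [hc] at hle ⊢
    obtain ⟨d, hd⟩ := Nat.exists_eq_add_of_le hle
    rw [show n - ((rowPositions σ).card + 1) = d by omega,
      show n - (rowPositions σ).card = d + 1 by omega, add_mul]
    omega
  · rw [rowPositions_update_of_ne_none hq]
    refine Nat.add_lt_add_left ?_ _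
    have h1 := hl (Function.update σ q (some p))
    rw [tableau_apply] at hT
    set x := (basisMatrix N σ).det
    set y := (basisMatrix N (Function.update σ q (some p))).det
    have h2 : x.natAbs ^ 2 * 2 ≤ y.natAbs ^ 2 := by
      zify
      rw [sq_abs, sq_abs]
      nlinarith [sq_nonneg x]
    have hx : x.natAbs ^ 2 ≠ 0 := by
      simpa using hdet
    have h3 := Nat.log_mono_right (b := 2) h2
    rw [Nat.log_mul_base (by norm_num) hx] at h3
    omega

theorem run_pivotLoop : ∃ c : ℕ, ∀ {n H : ℕ} {N : Matrix (Fin n) (Fin n) ℤ}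
    {s : State}, s.Within H → s.var 0 = n → s.var 1 = (n * n : ℕ) →
    HasBasis N (fun _ => none) s →
    (∀ σ p q, |tableau N σ p q| ≤ H) → (∀ σ, |(basisMatrix N σ).det| ≤ H) →
    ∃ s' σ, Run H pivotLoop s s' (c * ((n + 1) ^ 3 * ((n + 1) * (2 * H.size + 2)))) ∧
      HasBasis N σ s' ∧ (basisMatrix N σ).det ≠ 0 ∧ ∀ p q, ¬ Improvable N σ p q := by
  obtain ⟨c₁, hfind⟩ := run_findProg
  obtain ⟨c₂, hpivot⟩ := run_pivotProg
  refine ⟨c₁ + (c₂ + c₁ + 2), fun {n H N s} hs h0 h1 hb hT hD => ?_⟩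
  set l := 2 * H.size with hl
  have hlog : ∀ τ, Nat.log 2 ((basisMatrix N τ).det.natAbs ^ 2) ≤ l := by
    intro τ
    have h1 : (basisMatrix N τ).det.natAbs < 2 ^ H.size := by
      refine lt_of_le_of_lt ?_ (Nat.lt_size_self H)
      have := hD τ
      rw [Int.abs_eq_natAbs] at this
      exact_mod_cast this
    have h2 : (basisMatrix N τ).det.natAbs ^ 2 < 2 ^ (l + 1) := by
      calc (basisMatrix N τ).det.natAbs ^ 2 < (2 ^ H.size) ^ 2 :=
            Nat.pow_lt_pow_left h1 (by norm_num)
        _ = 2 ^ l := by rw [hl, ← pow_mul, mul_comm]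
        _ ≤ 2 ^ (l + 1) := Nat.pow_le_pow_right (by norm_num) (Nat.le_succ l)
    exact Nat.lt_succ_iff.1 (Nat.log_lt_of_lt_pow' (Nat.succ_ne_zero l) h2)
  obtain ⟨s1, r1, hr1⟩ := hfind hs h0 h1 hb
  have hb1 : HasBasis N (fun _ => none) s1 :=
    hb.congr (r1.arr_eq 8 (by decide)) (r1.var_eq 5 (by decide)) (r1.arr_eq 6 (by decide))
  obtain ⟨s2, μ', r2, ⟨σ, -, h20, h21, hb2, hdet2, hf2⟩, he⟩ := Run.while_of_measure
    (H := H) (e := .var 6) (p := .seq pivotProg findProg) (k := (c₂ + c₁) * (n + 1) ^ 3)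
    (fun μ s => ∃ σ, pivotMeasure N σ l ≤ μ ∧ s.var 0 = n ∧ s.var 1 = (n * n : ℕ) ∧
      HasBasis N σ s ∧ (basisMatrix N σ).det ≠ 0 ∧
      ((s.var 6 = 0 ∧ ∀ p q, ¬ Improvable N σ p q) ∨
        ∃ p q : Fin n, Improvable N σ p q ∧ s.var 6 = (p : ℤ) * n + q + 1)) (by
      rintro μ s hs ⟨σ, hμ, h0, h1, hb, hdet, hf⟩ hpos
      rcases hf with ⟨h6, -⟩ | ⟨p, q, hI, h6⟩
      · simp [Expr.eval, h6] at hpos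
      · obtain ⟨s', r, hb'⟩ := hpivot hs h0 h1 hb h6 hI.tableau_ne_zero hdet hT
        have h0' : s'.var 0 = n := (r.var_eq 0 (by decide)).trans h0
        have h1' : s'.var 1 = (n * n : ℕ) := (r.var_eq 1 (by decide)).trans h1
        obtain ⟨s'', r', hf'⟩ := hfind r.within h0' h1' hb'
        refine ⟨s'', _, r.seq_mul r', lt_of_lt_of_le (pivotMeasure_update_lt hlog hdet hI) hμ,
          _, le_rfl, (r'.var_eq 0 (by decide)).trans h0', (r'.var_eq 1 (by decide)).trans h1',
          hb'.congr (r'.arr_eq 8 (by decide)) (r'.var_eq 5 (by decide))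
            (r'.arr_eq 6 (by decide)), ?_, hf'⟩
        rw [← tableau_apply]
        exact hI.tableau_ne_zero)
    (pivotMeasure N (fun _ => none) l) s1 r1.within
    ⟨_, le_rfl, (r1.var_eq 0 (by decide)).trans h0, (r1.var_eq 1 (by decide)).trans h1, hb1,
      by simp [basisMatrix_none], hr1⟩
  refine ⟨s2, σ, Run.seq_mul (r1.mono ?_) (r2.mono ?_), hb2, hdet2, ?_⟩
  · refine Nat.mul_le_mul_left _ (Nat.le_mul_of_pos_right _ ?_)
    positivity
  -- The initial measure bounds the number of pivots, each of which takes a constant multiple of `(n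
  -- + 1) ^ 3` units.
  · have hm : pivotMeasure N (fun _ => none) l + 1 ≤ (n + 1) * (l + 2) := by
      unfold pivotMeasure
      have h2 : (n - (rowPositions fun _ : Fin n => (none : Option (Fin n))).card) * (l + 1) ≤
          n * (l + 1) := Nat.mul_le_mul_right _ (Nat.sub_le _ _)
      nlinarith [Nat.sub_le l (Nat.log 2 ((basisMatrix N fun _ => none).det.natAbs ^ 2))]
    have hk : (c₂ + c₁) * (n + 1) ^ 3 + (Expr.weight (.var 6)) ^ 2 + 1 ≤
        (c₂ + c₁ + 2) * (n + 1) ^ 3 := by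
      have := Nat.one_le_pow 3 (n + 1) (Nat.succ_pos n)
      simp only [Expr.weight]
      nlinarith
    calc (pivotMeasure N (fun _ => none) l + 1) *
          ((c₂ + c₁) * (n + 1) ^ 3 + (Expr.weight (.var 6)) ^ 2 + 1)
        ≤ ((n + 1) * (l + 2)) * ((c₂ + c₁ + 2) * (n + 1) ^ 3) := Nat.mul_le_mul hm hk
      _ = _ := by ring
  · rcases hf2 with ⟨-, h⟩ | ⟨p, q, -, h6⟩
    · exact h
    · simp only [Expr.eval, h6] at he
      have : (0 : ℤ) ≤ (p : ℤ) * n + q := by positivity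
      omega

end LogRAM

/-! ## Rank and resolution -/

namespace LogRAM

/-- The factor in the running time that depends on the input. -/
def timeUnit (n H : ℕ) : ℕ := (n + 1) ^ 3 * ((n + 1) * (2 * H.size + 2))

theorem mul_cube_le_timeUnit (n H c : ℕ) : c * (n + 1) ^ 3 ≤ c * timeUnit n H :=
  Nat.mul_le_mul_left _ (Nat.le_mul_of_pos_right _ (by positivity))

theorem mul_size_le_timeUnit (n H c : ℕ) : (H.size + 1) * c ≤ c * timeUnit n H := by
  rw [mul_comm]
  refine Nat.mul_le_mul_left _ ?_
  have h1 : 1 ≤ (n + 1) ^ 3 := Nat.one_le_pow _ _ (Nat.succ_pos n)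
  have h2 : H.size + 1 ≤ (n + 1) * (2 * H.size + 2) := by nlinarith [Nat.zero_le (n * H.size)]
  calc H.size + 1 ≤ (n + 1) * (2 * H.size + 2) := h2
    _ ≤ (n + 1) ^ 3 * ((n + 1) * (2 * H.size + 2)) := Nat.le_mul_of_pos_left _ h1

/-- The indicator of the basis positions that hold rows of the matrix. -/
def rankExpr : Expr := .sub (.const 1) (.isZero (.get 8 (.var 9)))

/-- Positive as long as the resolution is too coarse. -/
def coarseExpr : Expr :=
  .sub (.mul (.const 3) (.mul (.get 9 (.const 0)) (.var 4))) (.mul (.mul (.var 7) (.var 7)) (.var 3))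

/-- Compute the rank and a sufficient resolution. -/
def resolutionProg : Prog :=
  .seq (rowSum 9 0 9 rankExpr) <|
  .seq (.assign 7 (.const 1)) (.while coarseExpr (.assign 7 (.mul (.const 2) (.var 7))))

/-- The condition `3 * r * (C / L) ≤ m ^ 2` is the one from the existence proof, with `C / L` for
`c`. Doubling avoids square roots; the last clause, that half of `m` was too coarse, keeps the grid
small. -/
theorem run_resolutionProg : ∃ c : ℕ, ∀ {n H L C : ℕ} {N : Matrix (Fin n) (Fin n) ℤ}
    {σ : Fin n → Option (Fin n)} {s : State}, s.Within H → s.var 0 = n → s.var 3 = L →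
    s.var 4 = C → HasBasis N σ s → s.arr 9 0 = 0 → 0 < L → 1 ≤ H → 6 * (n * C) ≤ H →
    ∃ (s' : State) (m : ℕ), Run H resolutionProg s s' (c * timeUnit n H) ∧ s'.var 7 = m ∧
      1 ≤ m ∧ 3 * ((rowPositions σ).card * C) ≤ m * m * L ∧
      (m = 1 ∨ ∃ m', m = 2 * m' ∧ m' * m' * L < 3 * ((rowPositions σ).card * C)) := by
  refine ⟨(rankExpr.weight + 6) ^ 2 + 40 + (Expr.weight (.const 1) ^ 2 + 1 +
    (Expr.weight (.mul (.const 2) (.var 7)) ^ 2 + 1 + coarseExpr.weight ^ 2 + 1)),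
    fun {n H L C N σ s} hs h0 h3 h4 hb h9 hL hH hC => ?_⟩
  set r := (rowPositions σ).card with hr
  have hrn : r ≤ n := (Finset.card_le_univ _).trans (by simp)
  have hrC : 6 * (r * C) ≤ H :=
    le_trans (Nat.mul_le_mul_left _ (Nat.mul_le_mul_right _ hrn)) hC
  have hsum : ∑ q, (1 - zeroInd (basisCode (σ q))) = (r : ℤ) := by
    rw [hr, rowPositions, Finset.card_filter, Nat.cast_sum]
    refine Finset.sum_congr rfl fun q _ => ?_
    rw [zeroInd_basisCode]
    split_ifs <;> simp
  have hnH : n ≤ H := by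
    have := hs.1 0
    rw [h0, Nat.abs_cast] at this
    exact_mod_cast this
  obtain ⟨g, w, r1, hg⟩ := Run.rowSum_matrix (m := 1) (i := 9) (y := 0) (a := 9) (e := rankExpr)
    (fun _ q => 1 - zeroInd (basisCode (σ q))) hs (by decide) (by decide)
    (by simpa using h0) h0 (by simpa using h9)
    (fun _ q => by rcases zeroInd_eq (basisCode (σ q)) with h | h <;> simp [h])
    (fun _ => by rw [hsum]; exact_mod_cast hrn.trans hnH) (by
      intro p q g
      have hp : p = 0 := Subsingleton.elim _ _
      subst hp
      have := hb.basis q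
      simp [rankExpr, Expr.eval, this])
  have hg0 : g 0 = r := by simpa [hsum] using hg 0
  set s1 : State := ⟨Function.update s.var 9 w, Function.update s.arr 9 g⟩ with hs1
  have v13 : s1.var 3 = L := by rw [← h3]; simp [hs1]
  have v14 : s1.var 4 = C := by rw [← h4]; simp [hs1]
  have a19 : s1.arr 9 0 = r := by simp [hs1, hg0]
  have r2 := Run.assign r1.within 7 (.const 1) (by simpa [Expr.eval] using hH)
  obtain ⟨s', μ', r3, ⟨j, -, hj7, hj3, hj4, hj9, hjc⟩, he⟩ := Run.while_of_measure (H := H)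
    (e := coarseExpr) (p := .assign 7 (.mul (.const 2) (.var 7)))
    (k := Expr.weight (.mul (.const 2) (.var 7)) ^ 2 + 1)
    (fun μ s => ∃ j : ℕ, μ = H.size - j ∧ s.var 7 = (2 ^ j : ℕ) ∧ s.var 3 = L ∧ s.var 4 = C ∧
      s.arr 9 0 = r ∧ (2 ^ j = 1 ∨ ∃ m', 2 ^ j = 2 * m' ∧ m' * m' * L < 3 * (r * C))) (by
      rintro μ s hs ⟨j, rfl, h7, h3, h4, h9, -⟩ hpos
      simp only [coarseExpr, Expr.eval, h7, h3, h4, h9] at hpos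
      have hlt : 2 ^ j * 2 ^ j * L < 3 * (r * C) := by
        zify
        push_cast at hpos
        linarith
      have hpow : 1 ≤ 2 ^ j := Nat.one_le_two_pow
      -- As `L ≥ 1`, a true guard gives `2 ^ j < 3 * r * C`, so the doubled value is below `6 * r *
      -- C ≤ H`. This also bounds the number of doublings by `H.size`.
      have h2 : 2 ^ j ≤ 2 ^ j * 2 ^ j * L := by
        calc 2 ^ j ≤ 2 ^ j * (2 ^ j * L) := Nat.le_mul_of_pos_right _ (by positivity)
          _ = 2 ^ j * 2 ^ j * L := by ring
      have h3' : 2 ^ (j + 1) ≤ H := by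
        rw [pow_succ]
        omega
      have hsz : j + 1 < H.size := Nat.lt_size.2 h3'
      have hev : (Expr.mul (.const 2) (.var 7)).eval s = (2 ^ (j + 1) : ℕ) := by
        simp only [Expr.eval, h7]
        push_cast
        ring
      have hr := Run.assign hs 7 (.mul (.const 2) (.var 7)) (by
        rw [hev, Nat.abs_cast]
        exact_mod_cast h3')
      rw [hev] at hr
      refine ⟨_, H.size - (j + 1), hr, by omega, j + 1, rfl, ?_, ?_, ?_, h9,
        .inr ⟨2 ^ j, by rw [pow_succ, mul_comm], hlt⟩⟩
      · simp [State.setVar]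
      · simpa [State.setVar] using h3
      · simpa [State.setVar] using h4)
    H.size _ r2.within
    ⟨0, rfl, by simp [State.setVar, Expr.eval], by simpa [State.setVar] using v13,
      by simpa [State.setVar] using v14, a19, .inl rfl⟩
  refine ⟨s', 2 ^ j, Run.seq_mul (r1.mono ?_) (Run.seq_mul (r2.mono ?_) (r3.mono ?_)), hj7,
    Nat.one_le_two_pow, ?_, hjc⟩
  · exact (one_mul_le_mul_cube n _).trans (mul_cube_le_timeUnit n H _)
  · exact (le_mul_cube n _).trans (mul_cube_le_timeUnit n H _)
  · exact mul_size_le_timeUnit n H _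
  · simp only [coarseExpr, Expr.eval, hj7, hj3, hj4, hj9] at he
    zify
    push_cast at he
    linarith

/-! ## Clustering -/

/-- The indicator of the diagonal. -/
def diagExpr : Expr := .isZero (.sub rowExpr colExpr)

/-- The scaled error at a revealed entry. -/
def devExpr : Expr := .sub (.get 5 (.var 9)) (.mul (.var 3) diagExpr)

/-- The scaled squared error, with value `0` at entries that are not revealed. -/
def errExpr : Expr := .mul (.add diagExpr (.get 0 (.var 9))) (.mul devExpr devExpr)

/-- The cell of a vertex in one coordinate. -/
def cellExpr : Expr :=
  .mul (.sub (.const 1) (.isZero (.get 8 colExpr)))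
    (.div (.mul (.mul (.const 2) (.var 7)) (.add (.mul (.var 4) (.get 6 (.var 9)))
        (.mul (.var 5) (.get 5 (.add (.mul (.sub (.get 8 colExpr) (.const 1)) (.var 0)) rowExpr)))))
      (.mul (.const 5) (.mul (.var 4) (.var 5))))

/-- The indicator of different cells of two vertices in one coordinate. -/
def diffExpr : Expr :=
  .sub (.const 1) (.isZero (.sub
    (.get 11 (.add (.mul (.div rowExpr (.var 0)) (.var 0)) colExpr))
    (.get 11 (.add (.mul (.mod rowExpr (.var 0)) (.var 0)) colExpr))))

/-- The indicator of the good vertices in the class of the center. -/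
def memberExpr : Expr :=
  .mul (.isZero (.get 12 (.var 9)))
    (.isNeg (.sub (.mul (.const 4) (.get 10 colExpr)) (.mul (.var 3) (.var 3))))

/-- The better one of the current center and the best center so far. -/
def bestExpr : Expr :=
  .add (.var 8) (.mul (.isNeg (.sub (.get 14 (.var 8)) (.get 14 (.var 9)))) (.sub (.var 9) (.var 8)))

/-- The membership of a vertex in the class of the best center. -/
def outputExpr : Expr := .get 13 (.add (.mul (.var 8) (.var 0)) (.var 9))

/-- Find the largest class of good vertices in the same cell. -/
def clusterProg : Prog :=
  .seq (rowSum 9 1 10 errExpr) <|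
  .seq (fill 9 1 11 cellExpr) <|
  .seq (rowSum 9 2 12 diffExpr) <|
  .seq (fill 9 1 13 memberExpr) <|
  .seq (rowSum 9 1 14 (.get 13 (.var 9))) <|
  .seq (fold 9 0 8 bestExpr) (fill 9 0 4 outputExpr)

/-- The scaled squared error on the revealed entries of a row. -/
def scaledError {n : ℕ} (A N : Matrix (Fin n) (Fin n) ℤ) (L : ℕ) (i : Fin n) : ℤ :=
  ∑ j, ((if i = j then 1 else 0) + A i j) * (N i j - L * if i = j then 1 else 0) ^ 2

/-- The cell of a vertex in one coordinate. -/
def gridCell {n : ℕ} (N : Matrix (Fin n) (Fin n) ℤ) (σ : Fin n → Option (Fin n)) (m C : ℕ)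
    (i q : Fin n) : ℤ :=
  (σ q).elim 0 fun p => 2 * m * (C * tableau N σ i q + (basisMatrix N σ).det * N p i) /
    (5 * (C * (basisMatrix N σ).det))

/-- The indicator of the good vertices in the class of a center. -/
def member {n : ℕ} (A N : Matrix (Fin n) (Fin n) ℤ) (σ : Fin n → Option (Fin n)) (L m C : ℕ)
    (k i : Fin n) : ℤ :=
  if (∀ q, gridCell N σ m C k q = gridCell N σ m C i q) ∧ 4 * scaledError A N L i < L ^ 2
  then 1 else 0

/-- Without an improving pivot `2 * |T| ≤ 3 * |D|`; together with `|N| ≤ C` this gives `2 * |C * T +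
D * N| ≤ 5 * C * |D|`, and 5 is the constant in the divisor. -/
theorem abs_gridCell_le {n : ℕ} {N : Matrix (Fin n) (Fin n) ℤ} {σ : Fin n → Option (Fin n)}
    {C : ℕ} (m : ℕ) (hN : ∀ i j, |N i j| ≤ C) (hI : ∀ p q, ¬ Improvable N σ p q) (i q : Fin n) :
    |gridCell N σ m C i q| ≤ m := by
  unfold gridCell
  cases hq : σ q with
  | none => simp
  | some p =>
    simp only [Option.elim]
    set D := (basisMatrix N σ).det with hD
    have hT : 2 * |tableau N σ i q| ≤ 3 * |D| := by
      by_contra! h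
      refine hI i q (.inr ⟨by simp [hq], ?_⟩)
      have h2 := pow_lt_pow_left₀ h (by positivity) (by norm_num : 2 ≠ 0)
      rw [mul_pow, mul_pow, sq_abs, sq_abs] at h2
      linarith
    have hx : |2 * m * (C * tableau N σ i q + D * N p i)| ≤ m * |5 * (C * D)| := by
      rw [abs_mul, abs_mul (5 : ℤ), abs_mul (C : ℤ), abs_of_nonneg (by positivity : (0 : ℤ) ≤ 2 * m),
        Nat.abs_cast, abs_of_nonneg (by norm_num : (0 : ℤ) ≤ 5)]
      have h3 := abs_add_le (C * tableau N σ i q) (D * N p i)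
      rw [abs_mul, abs_mul, Nat.abs_cast] at h3
      have h4 := mul_le_mul_of_nonneg_left (hN p i) (abs_nonneg D)
      have h5 := mul_le_mul_of_nonneg_left hT (by positivity : (0 : ℤ) ≤ C)
      have h6 : 2 * |C * tableau N σ i q + D * N p i| ≤ 5 * (C * |D|) := by linarith
      calc 2 * (m : ℤ) * |C * tableau N σ i q + D * N p i|
          = m * (2 * |C * tableau N σ i q + D * N p i|) := by ring
        _ ≤ m * (5 * (C * |D|)) := mul_le_mul_of_nonneg_left h6 (by positivity)
    set x := 2 * m * (C * tableau N σ i q + D * N p i)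
    set y := 5 * (C * D)
    rcases eq_or_ne y 0 with hy | hy
    -- This occurs for the zero matrix, say; division by zero gives cell 0.
    · simp [hy]
    · obtain ⟨h1, h2⟩ := abs_le.1 hx
      rcases lt_or_gt_of_ne hy with hy | hy
      · rw [abs_of_neg hy] at h1 h2
        have e : x / y = -(x / -y) := by rw [Int.ediv_neg, neg_neg]
        rw [e, abs_neg, abs_le]
        exact ⟨(Int.le_ediv_iff_mul_le (by omega)).2 (by linarith),
          Int.ediv_le_of_le_mul (by omega) (by linarith)⟩
      · rw [abs_of_pos hy] at h1 h2
        rw [abs_le]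
        exact ⟨(Int.le_ediv_iff_mul_le hy).2 (by linarith),
          Int.ediv_le_of_le_mul hy (by linarith)⟩

theorem zeroInd_natCast_sub {n : ℕ} (i j : Fin n) :
    zeroInd (((i : ℕ) : ℤ) - (j : ℕ)) = if i = j then 1 else 0 := by
  split_ifs with h
  · subst h
    simp
  · refine zeroInd_of_ne fun h' => h (Fin.ext ?_)
    omega

/-- Each vertex serves as a candidate center, and a pair shares all cells exactly when its count of
differing coordinates is zero. The arrays that accumulate sums must start at zero. -/
theorem run_clusterProg : ∃ c : ℕ, ∀ {n H L C m : ℕ} {A N : Matrix (Fin n) (Fin n) ℤ}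
    {σ : Fin n → Option (Fin n)} {s : State}, s.Within H → s.var 0 = n →
    s.var 1 = (n * n : ℕ) → s.var 2 = (n * n * n : ℕ) → s.var 3 = L → s.var 4 = C →
    s.var 7 = m → s.var 8 = 0 → HasBasis N σ s →
    (∀ i j : Fin n, s.arr 0 ((i : ℤ) * n + j) = A i j) →
    (∀ i j : Fin n, s.arr 5 ((i : ℤ) * n + j) = N i j) →
    (∀ w, s.arr 10 w = 0) → (∀ w, s.arr 12 w = 0) → (∀ w, s.arr 14 w = 0) →
    (∀ i j, 0 ≤ A i j) → (∀ i, scaledError A N L i ≤ H) →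
    (∀ i j, |N i j| ≤ C) → (∀ p q, ¬ Improvable N σ p q) → 1 ≤ H →
    ∃ s', Run H clusterProg s s' (c * (n + 1) ^ 3) ∧ (0 < n → ∃ k : Fin n,
      (∀ i : Fin n, s'.arr 4 (i : ℕ) = member A N σ L m C k i) ∧
      ∀ k', ∑ i, member A N σ L m C k' i ≤ ∑ i, member A N σ L m C k i) := by
  refine ⟨(errExpr.weight + 6) ^ 2 + 40 + (cellExpr.weight ^ 2 + 40 +
    ((diffExpr.weight + 6) ^ 2 + 40 + (memberExpr.weight ^ 2 + 40 +
    ((Expr.weight (.get 13 (.var 9)) + 6) ^ 2 + 40 + (bestExpr.weight ^ 2 + 40 +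
    (outputExpr.weight ^ 2 + 40)))))),
    fun {n H L C m A N σ s} hs h0 h1 h2 h3 h4 h7 h8 hb hA hN h10 h12 h14 hA0 hE hC hI hH => ?_⟩
  have hnH : n ≤ H := by
    have := hs.1 0
    rw [h0, Nat.abs_cast] at this
    exact_mod_cast this
  have hmH : m ≤ H := by
    have := hs.1 7
    rw [h7, Nat.abs_cast] at this
    exact_mod_cast this
  -- errors
  obtain ⟨g1, w1, r1, hg1⟩ := Run.rowSum_matrix (i := 9) (y := 1) (a := 10) (e := errExpr)
    (fun i j => ((if i = j then 1 else 0) + A i j) * (N i j - L * if i = j then 1 else 0) ^ 2)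
    hs (by decide) (by decide) h1 h0 (fun w _ => h10 w)
    (fun i j => mul_nonneg (add_nonneg (by split_ifs <;> norm_num) (hA0 i j)) (sq_nonneg _))
    hE (by
      intro i j g
      simp only [errExpr, devExpr, diagExpr, rowExpr, colExpr, Expr.eval, Expr.eval_isZero,
        Expr.eval_mod]
      simp only [Function.update_apply, if_true, reduceIte, Nat.reduceEqDiff, OfNat.zero_ne_ofNat,
        h0, h3, flat_mod, flat_div, hA, hN, zeroInd_natCast_sub]
      ring)
  set s1 : State := ⟨Function.update s.var 9 w1, Function.update s.arr 10 g1⟩ with hs1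
  -- cells
  obtain ⟨g2, w2, r2, hg2⟩ := Run.fill_matrix (i := 9) (y := 1) (a := 11) (e := cellExpr)
    (gridCell N σ m C) r1.within (by decide) (by rw [← h1]; simp [hs1]) (by
      intro i q g
      refine ⟨?_, (abs_gridCell_le m hC hI i q).trans (by exact_mod_cast hmH)⟩
      have hq8 := hb.basis q
      simp only [cellExpr, rowExpr, colExpr, Expr.eval, Expr.eval_isZero, Expr.eval_mod, hs1]
      simp only [Function.update_apply, if_true, reduceIte, Nat.reduceEqDiff, OfNat.zero_ne_ofNat,
        h0, h4, h7, hb.det, flat_mod, flat_div, hb.tab, hq8]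
      unfold gridCell
      cases hq : σ q with
      | none => simp
      | some p =>
        have : zeroInd ((p : ℤ) + 1) = 0 := zeroInd_of_ne (by positivity)
        simp [hN, this])
  set s2 : State := ⟨Function.update s1.var 9 w2, Function.update s1.arr 11 g2⟩ with hs2
  have a2 : ∀ i j : Fin n, s2.arr 11 ((i : ℤ) * n + j) = gridCell N σ m C i j := by
    simpa [hs2] using hg2
  -- differences
  let ki : Fin (n * n) → Fin n × Fin n := finProdFinEquiv.symm
  have hki : ∀ p : Fin (n * n), ((p : ℕ) : ℤ) = ((ki p).1 : ℕ) * n + ((ki p).2 : ℕ) := by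
    intro p
    have h : ((ki p).2 : ℕ) + n * ((ki p).1 : ℕ) = p := Nat.mod_add_div p n
    rw [← h]
    push_cast
    ring
  have hsum3 : ∀ p : Fin (n * n), (∑ q, (1 - zeroInd (gridCell N σ m C (ki p).1 q -
      gridCell N σ m C (ki p).2 q))) ≤ (H : ℤ) := by
    intro p
    calc _ ≤ ∑ _q : Fin n, (1 : ℤ) := Finset.sum_le_sum fun q _ => by
          rcases zeroInd_eq (gridCell N σ m C (ki p).1 q - gridCell N σ m C (ki p).2 q) with h | h
            <;> simp [h]
      _ ≤ H := by simpa using hnH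
  obtain ⟨g3, w3, r3, hg3⟩ := Run.rowSum_matrix (i := 9) (y := 2) (a := 12) (e := diffExpr)
    (fun (p : Fin (n * n)) (q : Fin n) => 1 - zeroInd (gridCell N σ m C (ki p).1 q -
      gridCell N σ m C (ki p).2 q)) r2.within (by decide) (by decide)
    (by rw [← h2]; simp [hs2, hs1]) (by simp [hs2, hs1, h0]) (fun w _ => by simp [hs2, hs1, h12])
    (fun p q => by
      rcases zeroInd_eq (gridCell N σ m C (ki p).1 q - gridCell N σ m C (ki p).2 q) with h | h
        <;> simp [h]) hsum3 (by
      intro p q g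
      have v20 : s2.var 0 = n := by simp [hs2, hs1, h0]
      simp only [diffExpr, rowExpr, colExpr, Expr.eval, Expr.eval_isZero, Expr.eval_mod]
      simp only [Function.update_apply, if_true, reduceIte, Nat.reduceEqDiff, OfNat.zero_ne_ofNat,
        v20, flat_mod, flat_div, hki, a2])
  set s3 : State := ⟨Function.update s2.var 9 w3, Function.update s2.arr 12 g3⟩ with hs3
  have a3 : ∀ k i : Fin n, s3.arr 12 ((k : ℤ) * n + i) =
      ∑ q, (1 - zeroInd (gridCell N σ m C k q - gridCell N σ m C i q)) := by
    intro k i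
    have h := hg3 (finProdFinEquiv (k, i))
    rw [hki] at h
    simpa [ki, hs3] using h
  have a310 : ∀ i : Fin n, s3.arr 10 (i : ℕ) = scaledError A N L i := by
    intro i
    rw [scaledError, ← hg1 i]
    simp [hs3, hs2, hs1]
  -- members
  have hmem01 : ∀ k i, member A N σ L m C k i = 0 ∨ member A N σ L m C k i = 1 := by
    intro k i
    unfold member
    split_ifs <;> simp
  obtain ⟨g4, w4, r4, hg4⟩ := Run.fill_matrix (i := 9) (y := 1) (a := 13) (e := memberExpr)
    (member A N σ L m C) r3.within (by decide) (by rw [← h1]; simp [hs3, hs2, hs1]) (by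
      intro k i g
      have v30 : s3.var 0 = n := by simp [hs3, hs2, hs1, h0]
      have v33 : s3.var 3 = L := by rw [← h3]; simp [hs3, hs2, hs1]
      constructor
      · simp only [memberExpr, colExpr, Expr.eval, Expr.eval_isZero, Expr.eval_isNeg,
          Expr.eval_mod]
        simp only [Function.update_apply, if_true, reduceIte, Nat.reduceEqDiff,
          OfNat.zero_ne_ofNat, v30, v33, flat_mod, a3, a310]
        unfold member
        by_cases hc : ∀ q, gridCell N σ m C k q = gridCell N σ m C i q
        · have hz : ∑ q, (1 - zeroInd (gridCell N σ m C k q - gridCell N σ m C i q)) = 0 :=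
            Finset.sum_eq_zero fun q _ => by simp [hc q]
          rw [hz]
          by_cases he : 4 * scaledError A N L i < (L : ℤ) ^ 2
          · rw [negInd_of_neg (by nlinarith), if_pos ⟨hc, he⟩]
            simp
          · rw [negInd_of_nonneg (by nlinarith), if_neg fun h => he h.2]
            simp
        · rw [if_neg fun h => hc h.1, zeroInd_of_ne, zero_mul]
          obtain ⟨q, hq⟩ := not_forall.1 hc
          refine (Finset.sum_pos' (fun q _ => ?_) ⟨q, Finset.mem_univ q, ?_⟩).ne'
          · rcases zeroInd_eq (gridCell N σ m C k q - gridCell N σ m C i q) with h | h <;> simp [h]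
          · rw [zeroInd_of_ne (sub_ne_zero.2 hq)]
            norm_num
      · rcases hmem01 k i with h | h
        · simp [h]
        · rw [h]
          simpa using hH)
  set s4 : State := ⟨Function.update s3.var 9 w4, Function.update s3.arr 13 g4⟩ with hs4
  have a4 : ∀ k i : Fin n, s4.arr 13 ((k : ℤ) * n + i) = member A N σ L m C k i := by
    simpa [hs4] using hg4
  -- class sizes
  have hcount : ∀ k, ∑ i, member A N σ L m C k i ≤ (H : ℤ) := by
    intro k
    calc _ ≤ ∑ _i : Fin n, (1 : ℤ) := Finset.sum_le_sum fun i _ => by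
          rcases hmem01 k i with h | h <;> simp [h]
      _ ≤ H := by simpa using hnH
  obtain ⟨g5, w5, r5, hg5⟩ := Run.rowSum_matrix (i := 9) (y := 1) (a := 14)
    (e := .get 13 (.var 9)) (member A N σ L m C) r4.within (by decide) (by decide)
    (by rw [← h1]; simp [hs4, hs3, hs2, hs1]) (by simp [hs4, hs3, hs2, hs1, h0])
    (fun w _ => by simp [hs4, hs3, hs2, hs1, h14])
    (fun k i => by rcases hmem01 k i with h | h <;> simp [h]) hcount
    (by intro k i g; simp [Expr.eval, a4])
  set s5 : State := ⟨Function.update s4.var 9 w5, Function.update s4.arr 14 g5⟩ with hs5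
  have v50 : s5.var 0 = n := by simp [hs5, hs4, hs3, hs2, hs1, h0]
  have v58 : s5.var 8 = 0 := by simp [hs5, hs4, hs3, hs2, hs1, h8]
  -- the best center
  let cnt : ℕ → ℤ := fun k => s5.arr 14 k
  have hcnt : ∀ k : Fin n, cnt k = ∑ i, member A N σ L m C k i := by
    intro k
    simpa [cnt, hs5] using hg5 k
  -- `f z` is a center of largest class among those below `z`, with default 0. For `n > 0` the final
  -- value is below `n`, hence a vertex.
  obtain ⟨f, hf0, hfs⟩ : ∃ f : ℕ → ℕ, f 0 = 0 ∧
      ∀ z, f (z + 1) = if cnt (f z) - cnt z < 0 then z else f z :=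
    ⟨fun z => Nat.rec 0 (fun z acc => if cnt acc - cnt z < 0 then z else acc) z, rfl, fun _ => rfl⟩
  have hfle : ∀ z, f (z + 1) ≤ z := by
    intro z
    induction z with
    | zero => rw [hfs, hf0]; simp
    | succ z ih =>
      rw [hfs]
      split_ifs <;> omega
  have hfmax : ∀ z, ∀ w < z, cnt w ≤ cnt (f z) := by
    intro z
    induction z with
    | zero => simp
    | succ z ih =>
      intro w hw
      rw [hfs]
      rcases Nat.lt_succ_iff_lt_or_eq.1 hw with h | rfl
      · have := ih w h
        split_ifs <;> omega
      · split_ifs <;> omega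
  have r6 := Run.fold (i := 9) (y := 0) (v := 8) (e := bestExpr) (N := n)
    (fun z => ((f z : ℕ) : ℤ)) r5.within (by decide) (by decide) (by decide) v50
    (by rw [v58, hf0]; rfl) (by
      intro z hz
      constructor
      · have hev : bestExpr.eval ⟨Function.update (Function.update s5.var 8 ((f z : ℕ) : ℤ)) 9 z,
            s5.arr⟩ = f z + negInd (cnt (f z) - cnt z) * (z - f z) := by
          simp [bestExpr, Expr.eval, cnt]
        rw [hev, hfs]
        split_ifs with h
        · rw [negInd_of_neg h]
          ring
        · rw [negInd_of_nonneg (not_lt.1 h)]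
          ring
      · rw [Nat.abs_cast]
        exact_mod_cast (hfle z).trans (hz.le.trans hnH))
  set s6 : State := ⟨Function.update (Function.update s5.var 8 ((f n : ℕ) : ℤ)) 9 (n : ℤ), s5.arr⟩
    with hs6
  have v60 : s6.var 0 = n := by rw [← v50]; simp [hs6]
  have v68 : s6.var 8 = f n := by simp [hs6]
  have a613 : ∀ k i : Fin n, s6.arr 13 ((k : ℤ) * n + i) = member A N σ L m C k i := by
    simpa [hs6, hs5] using a4
  have hfn : 0 < n → f n < n := by
    intro hn
    obtain ⟨n', rfl⟩ := Nat.exists_eq_succ_of_ne_zero hn.ne'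
    exact Nat.lt_succ_of_le (hfle n')
  obtain ⟨g7, w7, r7, hg7⟩ := Run.fill_matrix (m := 1) (i := 9) (y := 0) (a := 4)
    (e := outputExpr) (fun _ i => member A N σ L m C ⟨f n, hfn i.pos⟩ i) r6.within (by decide)
    (by simpa using v60) (by
      intro p i g
      have hp : p = 0 := Subsingleton.elim _ _
      subst hp
      constructor
      · have := a613 ⟨f n, hfn i.pos⟩ i
        simpa [outputExpr, Expr.eval, v60, v68] using this
      · rcases hmem01 ⟨f n, hfn i.pos⟩ i with h | h
        · simp [h]
        · rw [h]
          simpa using hH)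
  refine ⟨_, (r1.mono (sq_mul_le_mul_cube n _)).seq_mul <|
    (r2.mono (sq_mul_le_mul_cube n _)).seq_mul <| (r3.mono (cube_mul_le_mul_cube n _)).seq_mul <|
    (r4.mono (sq_mul_le_mul_cube n _)).seq_mul <| (r5.mono (sq_mul_le_mul_cube n _)).seq_mul <|
    (r6.mono (by simpa using one_mul_le_mul_cube n _)).seq_mul <|
    r7.mono (one_mul_le_mul_cube n _), fun hn => ⟨⟨f n, hfn hn⟩, fun i => ?_, fun k' => ?_⟩⟩
  · simpa using hg7 0 i
  · rw [← hcnt, ← hcnt]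
    exact hfmax n k' k'.2

end LogRAM

/-! ## Correctness of the algorithm -/

open LogRAM in
theorem rowError_eq_scaledError_div {n L : ℕ} {G : SimpleGraph (Fin n)}
    {A N : Matrix (Fin n) (Fin n) ℤ} {M : Matrix (Fin n) (Fin n) ℝ} (hL : 0 < L)
    (hA : open Classical in ∀ i j, A i j = if G.Adj i j then 1 else 0)
    (hN : ∀ i j, (N i j : ℝ) = L * M i j) (i : Fin n) :
    rowError G M i = scaledError A N L i / (L : ℝ) ^ 2 := by
  classical
  have hL' : (L : ℝ) ≠ 0 := by exact_mod_cast hL.ne'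
  rw [eq_div_iff (pow_ne_zero 2 hL'), rowError, scaledError, Finset.sum_mul]
  push_cast
  refine Finset.sum_congr rfl fun j _ => ?_
  rw [hN, hA]
  push_cast
  rw [← mul_sub, mul_pow]
  ring

open LogRAM in
-- With equal quotients the numerators differ by the difference of their remainders, both in `[0,
-- |z|)`. This holds for divisors of either sign, so the sign of the determinant is irrelevant.
theorem abs_sub_le_of_gridCell_eq {n C m L : ℕ} {N : Matrix (Fin n) (Fin n) ℤ}
    {σ : Fin n → Option (Fin n)} (hC : 0 < C) (hm : 0 < m) (hL : 0 < L)
    (hdet : (basisMatrix N σ).det ≠ 0) {i j q p : Fin n} (hq : σ q = some p)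
    (h : gridCell N σ m C i q = gridCell N σ m C j q) :
    |((C / L : ℝ) * (tableau N σ i q / (basisMatrix N σ).det) + N p i / L) -
      ((C / L : ℝ) * (tableau N σ j q / (basisMatrix N σ).det) + N p j / L)| ≤
      5 * (C / L : ℝ) / (2 * m) := by
  simp only [gridCell, hq, Option.elim] at h
  set D := (basisMatrix N σ).det
  set x := 2 * (m : ℤ) * (C * tableau N σ i q + D * N p i) with hx
  set y := 2 * (m : ℤ) * (C * tableau N σ j q + D * N p j) with hy
  set z := 5 * ((C : ℤ) * D) with hz
  have hC' : (C : ℤ) ≠ 0 := by exact_mod_cast hC.ne'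
  have hz0 : z ≠ 0 := mul_ne_zero (by norm_num) (mul_ne_zero hC' hdet)
  have hxy : |x - y| ≤ |z| := by
    have h1 := Int.emod_add_mul_ediv x z
    have h2 := Int.emod_add_mul_ediv y z
    have h3 := Int.emod_nonneg x hz0
    have h4 := Int.emod_nonneg y hz0
    have h5 := Int.emod_lt_abs x hz0
    have h6 := Int.emod_lt_abs y hz0
    rw [← h] at h2
    rw [abs_le]
    constructor <;> linarith
  have hxy' : |(x : ℝ) - y| ≤ |(z : ℝ)| := by exact_mod_cast hxy
  have hD : (D : ℝ) ≠ 0 := by exact_mod_cast hdet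
  have hL' : (0 : ℝ) < L := by exact_mod_cast hL
  have hm' : (0 : ℝ) < m := by exact_mod_cast hm
  have e : ((C / L : ℝ) * (tableau N σ i q / D) + N p i / L) -
      ((C / L : ℝ) * (tableau N σ j q / D) + N p j / L) = ((x : ℝ) - y) / (2 * m * L * D) := by
    rw [hx, hy]
    push_cast
    field_simp
  have e2 : 5 * (C / L : ℝ) / (2 * m) = |(z : ℝ)| / |2 * m * L * (D : ℝ)| := by
    rw [← abs_div, hz]
    push_cast
    rw [show 5 * ((C : ℝ) * D) / (2 * m * L * D) = 5 * (C / L : ℝ) / (2 * m) by field_simp,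
      abs_of_nonneg (by positivity)]
  rw [e, e2, abs_div]
  gcongr

open LogRAM in
/-- The largest class of good vertices in a common cell is a large independent set. -/
theorem isIndepSet_and_indepBound_le {n L C m : ℕ} {G : SimpleGraph (Fin n)}
    {A N : Matrix (Fin n) (Fin n) ℤ} {M : Matrix (Fin n) (Fin n) ℝ} {σ : Fin n → Option (Fin n)}
    {k : Fin n} {T : Finset (Fin n)} (hL : 0 < L)
    (hA : open Classical in ∀ i j, A i j = if G.Adj i j then 1 else 0)
    (hN : ∀ i j, (N i j : ℝ) = L * M i j)
    (hNC : ∀ i j, |N i j| ≤ C) (hC : C = 0 ∨ ∃ i j, |N i j| = C)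
    (hdet : (basisMatrix N σ).det ≠ 0) (hI : ∀ p q, ¬ Improvable N σ p q)
    (hm1 : 1 ≤ m) (hm2 : 3 * ((rowPositions σ).card * C) ≤ m * m * L)
    (hm3 : m = 1 ∨ ∃ m', m = 2 * m' ∧ m' * m' * L < 3 * ((rowPositions σ).card * C))
    (hT : ∀ i, i ∈ T ↔ member A N σ L m C k i = 1)
    (hk : ∀ k', ∑ i, member A N σ L m C k' i ≤ ∑ i, member A N σ L m C k i)
    {r : ℕ} {c ε : ℝ} (hcr : 1 ≤ c * r) (h : IsApproxCompletion G M r c ε) :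
    G.IsIndepSet (T : Set (Fin n)) ∧ indepBound n r c ε ≤ (T.card : ℝ) := by
  classical
  have hL' : (0 : ℝ) < L := by exact_mod_cast hL
  have hm' : (0 : ℝ) < m := by exact_mod_cast hm1
  set Nr : Matrix (Fin n) (Fin n) ℝ := N.map (Int.castRingHom ℝ) with hNr
  have hNrM : Nr = (L : ℝ) • M := by
    ext i j
    simp [hNr, hN]
  have hdetr : (basisMatrix Nr σ).det = ((basisMatrix N σ).det : ℝ) := by
    rw [hNr, map_basisMatrix]
    exact ((Int.castRingHom ℝ).map_det _).symm
  have htab : ∀ i q, tableau Nr σ i q = ((tableau N σ i q : ℤ) : ℝ) := by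
    intro i q
    rw [hNr, map_tableau]
    rfl
  have hdetr0 : (basisMatrix Nr σ).det ≠ 0 := by
    rw [hdetr]
    exact_mod_cast hdet
  have hunit : ∀ p q, σ q = none → tableau Nr σ p q = 0 := by
    intro p q hq
    rw [htab]
    by_contra h0
    exact hI p q (.inl ⟨hq, by exact_mod_cast h0⟩)
  have hrank : r = (rowPositions σ).card := by
    rw [← rank_eq_card_rowPositions hdetr0 hunit, ← h.rank_eq]
    have hM : M = (L : ℝ)⁻¹ • Nr := by
      rw [hNrM, smul_smul, inv_mul_cancel₀ hL'.ne', one_smul]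
    apply le_antisymm
    · conv_lhs => rw [hM, ← Matrix.mul_one Nr, ← Matrix.mul_smul]
      exact Matrix.rank_mul_le_left _ _
    · rw [hNrM, ← Matrix.mul_one M, ← Matrix.mul_smul, Matrix.mul_one]
      exact Matrix.rank_mul_le_left _ _
  have hr0 : r ≠ 0 := by
    rintro rfl
    norm_num at hcr
  have hc : 0 < c := by
    by_contra! hc
    have : c * r ≤ 0 := mul_nonpos_of_nonpos_of_nonneg hc (Nat.cast_nonneg r)
    linarith
  have hC0 : 0 < C := by
    rcases Nat.eq_zero_or_pos C with rfl | hC0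
    · exfalso
      have hM0 : M = 0 := by
        ext i j
        have h1 : N i j = 0 := by simpa using hNC i j
        have h2 := hN i j
        rw [h1, Int.cast_zero, eq_comm] at h2
        simpa [hL'.ne'] using h2
      have := h.rank_eq
      rw [hM0, Matrix.rank_zero] at this
      exact hr0 this.symm
    · exact hC0
  have hC' : (0 : ℝ) < C := by exact_mod_cast hC0
  -- `C / L` is the largest absolute value of an entry of `M`; any admissible `c` is at least that,
  -- so the computed grid is fine enough without knowing `c`.
  have hCc : (C : ℝ) ≤ c * L := by
    rcases hC with h0 | ⟨i, j, hij⟩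
    · exact absurd h0 hC0.ne'
    · have h1 := h.abs_le i j
      have h2 : |(N i j : ℝ)| = C := by exact_mod_cast hij
      rw [← h2, hN, abs_mul, abs_of_pos hL', mul_comm]
      exact mul_le_mul_of_nonneg_right h1 hL'.le
  have hgood : ∀ i, i ∈ goodSet G M ↔ 4 * scaledError A N L i < (L : ℤ) ^ 2 := by
    intro i
    rw [goodSet, Finset.mem_filter, rowError_eq_scaledError_div hL hA hN,
      div_lt_iff₀ (by positivity)]
    simp only [Finset.mem_univ, true_and]
    constructor
    · intro h1
      have : (4 * scaledError A N L i : ℝ) < (L : ℝ) ^ 2 := by linarith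
      exact_mod_cast this
    · intro h1
      have : (4 * scaledError A N L i : ℝ) < (L : ℝ) ^ 2 := by exact_mod_cast h1
      linarith
  have hmem : ∀ k' i, member A N σ L m C k' i = 1 ↔
      i ∈ cellClass (goodSet G M) (rowPositions σ) (gridCell N σ m C) k' := by
    intro k' i
    rw [cellClass, Finset.mem_filter, hgood, member, ite_eq_left_iff]
    simp only [zero_ne_one, imp_false, not_not]
    constructor
    · exact fun h1 => ⟨h1.2, fun q _ => (h1.1 q).symm⟩
    · refine fun h1 => ⟨fun q => ?_, h1.1⟩
      -- At unit vector positions every cell is 0, so comparing all coordinates is the same as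
      -- comparing the row positions.
      by_cases hq : q ∈ rowPositions σ
      · exact (h1.2 q hq).symm
      · have : σ q = none := by simpa [rowPositions] using hq
        simp [gridCell, this]
  have hcard : ∀ k', ∑ i, member A N σ L m C k' i =
      ((cellClass (goodSet G M) (rowPositions σ) (gridCell N σ m C) k').card : ℤ) := by
    intro k'
    have h1 : ∀ i, member A N σ L m C k' i =
        if i ∈ cellClass (goodSet G M) (rowPositions σ) (gridCell N σ m C) k' then 1 else 0 := by
      intro i
      split_ifs with h2
      · exact (hmem k' i).2 h2
      · have h3 := mt (hmem k' i).1 h2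
        unfold member at h3 ⊢
        split_ifs at h3 ⊢ with h4
        · exact absurd rfl h3
        · rfl
    rw [Finset.sum_congr rfl fun i _ => h1 i]
    simp
  have hTeq : T = cellClass (goodSet G M) (rowPositions σ) (gridCell N σ m C) k := by
    ext i
    rw [hT, hmem]
  rw [hTeq]
  constructor
  · refine isIndepSet_cellClass (μ := (C / L : ℝ)) (h := 5 * (C / L : ℝ) / (2 * m))
      (a := fun i q => tableau N σ i q / (basisMatrix N σ).det)
      (b := fun j q => basisMatrix Nr σ q j / L) ?_ (by positivity) ?_ ?_ k
    · intro i j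
      have h1 := eq_sum_rowPositions hdetr0 hunit i j
      have h2 : M i j = Nr i j / L := by
        rw [hNrM, Matrix.smul_apply, smul_eq_mul]
        field_simp
      rw [h2, h1, Finset.sum_div]
      refine Finset.sum_congr rfl fun q _ => ?_
      rw [htab, hdetr, mul_div_assoc]
    · intro i j q hq hij
      obtain ⟨p, hp⟩ := Option.isSome_iff_exists.1 (Finset.mem_filter.1 hq).2
      have hb : ∀ j, basisMatrix Nr σ q j = N p j := fun j => by simp [basisMatrix, hp, hNr]
      simp only [hb]
      exact abs_sub_le_of_gridCell_eq hC0 hm1 hL hdet hp hij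
    · have h1 : (3 * ((rowPositions σ).card * C) : ℝ) ≤ m * m * L := by exact_mod_cast hm2
      rw [div_pow, mul_div_assoc', div_le_iff₀ (by positivity)]
      have h2 : (0 : ℝ) ≤ C / L ^ 2 := by positivity
      have h3 := mul_le_mul_of_nonneg_left h1 h2
      have h4 : (C / L ^ 2 : ℝ) * (m * m * L) = C / L * m ^ 2 := by field_simp
      have h5 : (C / L ^ 2 : ℝ) * (3 * ((rowPositions σ).card * C)) =
          3 * ((rowPositions σ).card * (C / L) ^ 2) := by field_simp
      rw [h4, h5] at h3
      nlinarith
  · refine indepBound_le (m := m) hcr (le_card_goodSet hcr h) ?_ ?_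
    · rw [hrank]
      refine card_le_of_card_cellClass_le (fun i q _ => abs_gridCell_le m hNC hI i q) fun k' _ => ?_
      have := hk k'
      rw [hcard, hcard] at this
      exact_mod_cast this
    · have hx1 : 1 ≤ √(c * r) := Real.one_le_sqrt.2 hcr
      rcases hm3 with rfl | ⟨m', rfl, hm3⟩
      · push_cast
        linarith
      · rw [← hrank] at hm3
        have h1 : (m' * m' * L : ℝ) < 3 * (r * C) := by exact_mod_cast hm3
        have hr' : (0 : ℝ) ≤ r := Nat.cast_nonneg r
        have h2 : (m' * m' : ℝ) * L < 3 * (c * r) * L := by nlinarith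
        have h3 : (m' * m' : ℝ) < 3 * (c * r) := lt_of_mul_lt_mul_right h2 hL'.le
        have h4 : √(c * r) ^ 2 = c * r := Real.sq_sqrt (by linarith)
        -- `7 / 4` is a rational above `√3`; then `2 * m + 1 = 4 * m' + 1 ≤ 7 * √(c * r) + 1`, which
        -- uses up the constant 8.
        have h5 : (m' : ℝ) ≤ 7 / 4 * √(c * r) :=
          abs_le_of_sq_le_sq' (by nlinarith) (by positivity) |>.2
        push_cast
        linarith

/-! ### Bit length estimates and the complete algorithm. -/

namespace GraphMatrixInput

open LogRAM

theorem flatten_apply {n : ℕ} (A : Fin n → Fin n → ℤ) (i j : Fin n) :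
    flatten A ((i : ℤ) * n + j) = A i j := by
  unfold flatten
  rw [Finset.sum_eq_single i, Finset.sum_eq_single j]
  · simp
  · intro j' _ hj
    rw [if_neg]
    exact fun h => hj (flat_inj h).2.symm
  · simp
  · intro i' _ hi
    refine Finset.sum_eq_zero fun j' _ => if_neg fun h => hi (flat_inj h).1.symm
  · simp

theorem abs_flatten_le {n H : ℕ} {A : Fin n → Fin n → ℤ} (hA : ∀ i j, |A i j| ≤ H) (z : ℤ) :
    |flatten A z| ≤ H := by
  by_cases h : ∃ i j : Fin n, z = (i : ℤ) * n + j
  · obtain ⟨i, j, rfl⟩ := h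
    rw [flatten_apply]
    exact hA i j
  · have : flatten A z = 0 := Finset.sum_eq_zero fun i _ => Finset.sum_eq_zero fun j _ =>
      if_neg fun h' => h ⟨i, j, h'⟩
    simp [this]

/-- A common denominator of the entries. -/
def denProd (x : GraphMatrixInput) : ℕ := ∏ i, ∏ j, (x.M i j).den

/-- The integer multiple of the matrix. -/
def intM (x : GraphMatrixInput) : Matrix (Fin x.n) (Fin x.n) ℤ :=
  Matrix.of fun i j => (x.M i j).num * (x.denProd / (x.M i j).den : ℕ)

theorem denProd_pos (x : GraphMatrixInput) : 0 < x.denProd :=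
  Finset.prod_pos fun i _ => Finset.prod_pos fun j _ => (x.M i j).den_pos

theorem intM_cast (x : GraphMatrixInput) (i j : Fin x.n) :
    (x.intM i j : ℝ) = x.denProd * x.realM i j := by
  have hd : (x.M i j).den ∣ x.denProd :=
    (Finset.dvd_prod_of_mem (fun j => (x.M i j).den) (Finset.mem_univ j)).trans
      (Finset.dvd_prod_of_mem (fun i => ∏ j, (x.M i j).den) (Finset.mem_univ i))
  have h0 : ((x.M i j).den : ℝ) ≠ 0 := by exact_mod_cast (x.M i j).den_nz
  simp only [intM, Matrix.of_apply, realM, Matrix.map_apply]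
  rw [Int.cast_mul, Int.cast_natCast, Nat.cast_div hd h0, Rat.cast_def]
  field_simp

theorem sq_le_size (x : GraphMatrixInput) : x.n * x.n ≤ x.size := by
  calc x.n * x.n = ∑ _i : Fin x.n, ∑ _j : Fin x.n, 1 := by simp
    _ ≤ x.size := Finset.sum_le_sum fun i _ => Finset.sum_le_sum fun j _ => by omega

theorem n_le_size (x : GraphMatrixInput) : x.n ≤ x.size :=
  (Nat.le_mul_self x.n).trans x.sq_le_size

theorem natAbs_lt_two_pow_bits' (z : ℤ) : z.natAbs < 2 ^ bits z :=
  (natAbs_lt_two_pow_bits z).trans_le (Nat.pow_le_pow_right (by norm_num) (Nat.sub_le _ _))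

theorem denProd_le (x : GraphMatrixInput) : x.denProd ≤ 2 ^ x.size := by
  unfold denProd size
  rw [← Finset.prod_pow_eq_pow_sum]
  refine Finset.prod_le_prod' fun i _ => ?_
  rw [← Finset.prod_pow_eq_pow_sum]
  refine Finset.prod_le_prod' fun j _ => ?_
  have := natAbs_lt_two_pow_bits' ((x.M i j).den : ℤ)
  rw [Int.natAbs_natCast] at this
  exact this.le.trans (Nat.pow_le_pow_right (by norm_num) (by omega))

theorem num_le (x : GraphMatrixInput) (i j : Fin x.n) : |(x.M i j).num| ≤ (2 ^ x.size : ℕ) := by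
  rw [Int.abs_eq_natAbs]
  refine Nat.cast_le.2 ((natAbs_lt_two_pow_bits' _).le.trans
    (Nat.pow_le_pow_right (by norm_num) ?_))
  have h1 : ∑ j, (1 + bits (x.M i j).num + bits ((x.M i j).den : ℤ)) ≤ x.size :=
    Finset.single_le_sum (f := fun i => ∑ j, (1 + bits (x.M i j).num + bits ((x.M i j).den : ℤ)))
      (fun _ _ => Nat.zero_le _) (Finset.mem_univ i)
  have h2 : 1 + bits (x.M i j).num + bits ((x.M i j).den : ℤ) ≤
      ∑ j, (1 + bits (x.M i j).num + bits ((x.M i j).den : ℤ)) :=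
    Finset.single_le_sum (f := fun j => 1 + bits (x.M i j).num + bits ((x.M i j).den : ℤ))
      (fun _ _ => Nat.zero_le _) (Finset.mem_univ j)
  omega

theorem den_le (x : GraphMatrixInput) (i j : Fin x.n) : (x.M i j).den ≤ 2 ^ x.size := by
  refine le_trans (Nat.le_of_dvd x.denProd_pos ?_) x.denProd_le
  exact (Finset.dvd_prod_of_mem (fun j => (x.M i j).den) (Finset.mem_univ j)).trans
    (Finset.dvd_prod_of_mem (fun i => ∏ j, (x.M i j).den) (Finset.mem_univ i))

theorem intM_le (x : GraphMatrixInput) (i j : Fin x.n) :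
    |x.intM i j| ≤ (2 ^ (2 * x.size) : ℕ) := by
  simp only [intM, Matrix.of_apply]
  rw [abs_mul, Nat.abs_cast, two_mul, pow_add, Nat.cast_mul]
  refine mul_le_mul (x.num_le i j) (Nat.cast_le.2 ((Nat.div_le_self _ _).trans x.denProd_le))
    (by positivity) (by positivity)

/-- The Leibniz expansion gives `n!` times the `n`th power of the largest entry, and `n` is at most
the input size. Through `tableau_apply` this bounds all tableaux as well. -/
theorem det_basisMatrix_le (x : GraphMatrixInput) (σ : Fin x.n → Option (Fin x.n)) :
    |(basisMatrix x.intM σ).det| ≤ (2 ^ (3 * x.size ^ 2) : ℕ) := by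
  have h1 : ∀ i j, |basisMatrix x.intM σ i j| ≤ ((2 ^ (2 * x.size) : ℕ) : ℤ) := by
    intro i j
    cases h : σ i with
    | some p => simpa [basisMatrix, h] using x.intM_le p j
    | none =>
      simp only [basisMatrix, Matrix.of_apply, h, Option.elim]
      have h3 : (1 : ℤ) ≤ (2 ^ (2 * x.size) : ℕ) := by exact_mod_cast Nat.one_le_two_pow
      split_ifs
      · simpa using h3
      · simp
  have h2 := Matrix.det_le (abv := (AbsoluteValue.abs : AbsoluteValue ℤ ℤ)) h1
  simp only [AbsoluteValue.abs_apply, Fintype.card_fin, nsmul_eq_mul] at h2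
  refine h2.trans ?_
  rw [← Nat.cast_pow, ← Nat.cast_mul]
  refine Nat.cast_le.2 ?_
  have hn := x.n_le_size
  calc x.n.factorial * (2 ^ (2 * x.size)) ^ x.n
      ≤ (2 ^ x.size) ^ x.n * (2 ^ (2 * x.size)) ^ x.n := by
        refine Nat.mul_le_mul_right _ ((Nat.factorial_le_pow x.n).trans ?_)
        exact Nat.pow_le_pow_left (hn.trans Nat.lt_two_pow_self.le) _
    _ = 2 ^ (3 * x.size * x.n) := by
        rw [← mul_pow, ← pow_add, ← pow_mul]
        congr 1
        ring
    _ ≤ 2 ^ (3 * x.size ^ 2) := Nat.pow_le_pow_right (by norm_num) (by nlinarith)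

/-- A bound for all the integers that occur in the computation. -/
def valueBound (x : GraphMatrixInput) : ℕ := 2 ^ (6 * (x.size + 1) ^ 2)

theorem two_pow_le_valueBound (x : GraphMatrixInput) {k : ℕ} (hk : k ≤ 6 * (x.size + 1) ^ 2) :
    2 ^ k ≤ x.valueBound := Nat.pow_le_pow_right (by norm_num) hk

/-- The adjacency matrix with integer entries. -/
noncomputable def adj (x : GraphMatrixInput) : Matrix (Fin x.n) (Fin x.n) ℤ :=
  open Classical in Matrix.of fun i j => if x.G.Adj i j then 1 else 0

theorem scaledError_le (x : GraphMatrixInput) (i : Fin x.n) :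
    scaledError x.adj x.intM x.denProd i ≤ (2 ^ (5 * x.size + 3) : ℕ) := by
  classical
  have h1 : ∀ j, ((if i = j then 1 else 0) + x.adj i j) *
      (x.intM i j - x.denProd * if i = j then 1 else 0) ^ 2 ≤ (2 ^ (4 * x.size + 3) : ℤ) := by
    intro j
    have h2 : |x.intM i j - x.denProd * if i = j then 1 else 0| ≤ 2 * 2 ^ (2 * x.size) := by
      have h3 := x.intM_le i j
      have h4 : |(x.denProd : ℤ) * if i = j then 1 else 0| ≤ 2 ^ (2 * x.size) := by
        have h5 : (x.denProd : ℤ) ≤ 2 ^ (2 * x.size) := by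
          exact_mod_cast x.denProd_le.trans (Nat.pow_le_pow_right (by norm_num) (by omega))
        split_ifs
        · simpa using h5
        · simp
      push_cast at h3
      refine (abs_sub _ _).trans ?_
      linarith
    have h3 := pow_le_pow_left₀ (abs_nonneg _) h2 2
    rw [sq_abs] at h3
    have h4 : (if i = j then (1 : ℤ) else 0) + x.adj i j ≤ 2 := by
      simp only [adj, Matrix.of_apply]
      split_ifs <;> norm_num
    calc _ ≤ 2 * (2 * 2 ^ (2 * x.size)) ^ 2 := mul_le_mul h4 h3 (sq_nonneg _) (by norm_num)
      _ = (2 ^ (4 * x.size + 3) : ℤ) := by ring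
  refine (Finset.sum_le_sum fun j _ => h1 j).trans ?_
  rw [Finset.sum_const, Finset.card_univ, Fintype.card_fin, nsmul_eq_mul,
    show 5 * x.size + 3 = x.size + (4 * x.size + 3) by ring, pow_add 2 x.size]
  push_cast
  refine mul_le_mul_of_nonneg_right ?_ (by positivity)
  exact_mod_cast x.n_le_size.trans Nat.lt_two_pow_self.le

theorem load_within (x : GraphMatrixInput) (k : ℕ) (w : Fin k → Bool) :
    (x.load k w).Within x.valueBound := by
  classical
  have h1 : 1 ≤ x.valueBound := Nat.one_le_two_pow
  have hS : 2 ^ x.size ≤ x.valueBound := x.two_pow_le_valueBound (by nlinarith)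
  constructor
  · intro v
    simp only [load]
    split_ifs
    · rw [Nat.abs_cast]
      exact_mod_cast x.n_le_size.trans (Nat.lt_two_pow_self.le.trans hS)
    · simp
  · intro a z
    simp only [load]
    split
    · refine abs_flatten_le (fun i j => ?_) z
      split_ifs
      · simpa using h1
      · simp
    · exact abs_flatten_le (fun i j => (x.num_le i j).trans (by exact_mod_cast hS)) z
    · refine abs_flatten_le (fun i j => ?_) z
      rw [Nat.abs_cast]
      exact_mod_cast (x.den_le i j).trans hS
    · have h2 : (∑ l : Fin k, if z = (l : ℤ) ∧ w l = true then (1 : ℤ) else 0) =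
          ((Finset.univ.filter fun l : Fin k => z = (l : ℤ) ∧ w l = true).card : ℤ) := by
        simp
      have h3 : (Finset.univ.filter fun l : Fin k => z = (l : ℤ) ∧ w l = true).card ≤ 1 := by
        refine Finset.card_le_one.2 fun a ha b hb => ?_
        have ha' := (Finset.mem_filter.1 ha).2.1
        have hb' := (Finset.mem_filter.1 hb).2.1
        exact Fin.ext (by omega)
      rw [h2, Nat.abs_cast]
      exact_mod_cast h3.trans h1
    · simp

/-- The algorithm for finding a large independent set. -/
def indepProg : Prog :=
  .seq scaleProg (.seq pivotLoop (.seq resolutionProg clusterProg))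

/-- The final memory is fixed before `r`, `c` and `ε`, so the same output meets every admissible
bound; it does so for every string `w`. -/
theorem exists_exec_indepProg : ∃ c : ℕ, ∀ (x : GraphMatrixInput) (k : ℕ) (w : Fin k → Bool),
    ∃ (s : State) (t : ℕ), Exec indepProg (x.load k w) s t ∧ t ≤ c * (x.size + 1) ^ 8 ∧
      ∀ (r : ℕ) (c ε : ℝ), 1 ≤ c * r → IsApproxCompletion x.G x.realM r c ε →
        x.G.IsIndepSet (x.output s : Set (Fin x.n)) ∧
          indepBound x.n r c ε ≤ ((x.output s).card : ℝ) := by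
  classical
  obtain ⟨c₁, hscale⟩ := run_scaleProg
  obtain ⟨c₂, hpivot⟩ := run_pivotLoop
  obtain ⟨c₃, hres⟩ := run_resolutionProg
  obtain ⟨c₄, hcluster⟩ := run_clusterProg
  refine ⟨128 * (c₁ + (c₂ + (c₃ + c₄))), fun x k w => ?_⟩
  set n := x.n with hn
  set S := x.size with hS
  set H := x.valueBound with hH
  have hH1 : 1 ≤ H := Nat.one_le_two_pow
  have hnS : n ≤ 2 ^ S := x.n_le_size.trans Nat.lt_two_pow_self.le
  have hEn : S ≤ S ^ 2 := Nat.le_self_pow (by norm_num) S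
  have hE : ∀ e : ℕ, e ≤ 6 * S ^ 2 + 12 * S + 6 → 2 ^ e ≤ H := fun e he =>
    x.two_pow_le_valueBound (by rw [← hS]; nlinarith)
  have hdet : ∀ σ, |(basisMatrix x.intM σ).det| ≤ (H : ℤ) := fun σ =>
    (x.det_basisMatrix_le σ).trans (Nat.cast_le.2 (hE _ (by rw [← hS]; omega)))
  have htab : ∀ σ p q, |tableau x.intM σ p q| ≤ (H : ℤ) := fun σ p q => by
    rw [tableau_apply]
    exact hdet _
  obtain ⟨s1, C, r1, v11, v12, v13, v14, v15, a15, a16, hC, hC'⟩ := hscale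
    (num := fun i j => (x.M i j).num) (den := fun i j => (x.M i j).den) (n := n)
    (x.load_within k w) (by simp [load, hn]) (by simp [load])
    (fun i j => by simp only [load]; exact flatten_apply _ i j)
    (fun i j => by simp only [load]; exact flatten_apply (fun i j => ((x.M i j).den : ℤ)) i j)
    (fun i j => (x.M i j).den_pos)
    (by
      calc n ^ 3 ≤ (2 ^ S) ^ 3 := Nat.pow_le_pow_left hnS 3
        _ = 2 ^ (S * 3) := by rw [← pow_mul]
        _ ≤ H := hE _ (by omega))
    hH1 (x.denProd_le.trans (hE _ (by rw [← hS]; omega)))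
    (fun i j => (x.intM_le i j).trans (Nat.cast_le.2 (hE _ (by rw [← hS]; omega))))
  have hCN : ∀ i j, |x.intM i j| ≤ (C : ℤ) := hC
  have hCN' : C = 0 ∨ ∃ i j, |x.intM i j| = (C : ℤ) := hC'
  have hCle : C ≤ 2 ^ (2 * S) := by
    rcases hCN' with h | ⟨i, j, h⟩
    · rw [h]
      exact Nat.zero_le _
    · have := x.intM_le i j
      rw [h] at this
      exact_mod_cast this
  have v10 : s1.var 0 = n := (r1.var_eq 0 (by decide)).trans (by simp [load, hn])
  have hb1 : HasBasis x.intM (fun _ => none) s1 := by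
    refine ⟨fun q => ?_, ?_, fun i j => ?_⟩
    · rw [r1.arr_eq 8 (by decide)]
      simp [load]
    · rw [v15, basisMatrix_none, Matrix.det_one]
    · rw [tableau_none]
      exact a16 i j
  obtain ⟨s2, σ, r2, hb2, hdet2, hI⟩ := hpivot r1.within v10 v11 hb1 htab hdet
  have var2 : ∀ v, v ∉ pivotLoop.wvars → s2.var v = s1.var v := fun v hv => r2.var_eq v hv
  have arr2 : ∀ a, a ∉ pivotLoop.warrs → s2.arr a = s1.arr a := fun a ha => r2.arr_eq a ha
  have arr1 : ∀ a, a ∉ scaleProg.warrs → s1.arr a = (x.load k w).arr a := fun a ha =>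
    r1.arr_eq a ha
  obtain ⟨s3, m, r3, v37, hm1, hm2, hm3⟩ := hres (C := C) (L := x.denProd) r2.within
    ((var2 0 (by decide)).trans v10) ((var2 3 (by decide)).trans v13)
    ((var2 4 (by decide)).trans v14) hb2
    (by rw [arr2 9 (by decide), arr1 9 (by decide)]; simp [load]) x.denProd_pos hH1
    (by
      calc 6 * (n * C) ≤ 2 ^ 3 * (2 ^ S * 2 ^ (2 * S)) :=
            Nat.mul_le_mul (by norm_num) (Nat.mul_le_mul hnS hCle)
        _ = 2 ^ (3 + (S + 2 * S)) := by rw [← pow_add, ← pow_add]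
        _ ≤ H := hE _ (by omega))
  have var3 : ∀ v, v ∉ resolutionProg.wvars → s3.var v = s2.var v := fun v hv => r3.var_eq v hv
  have arr3 : ∀ a, a ∉ resolutionProg.warrs → s3.arr a = s2.arr a := fun a ha => r3.arr_eq a ha
  obtain ⟨s4, r4, hout⟩ := hcluster (A := x.adj) (C := C) (L := x.denProd) (m := m) r3.within
    (by rw [var3 0 (by decide), var2 0 (by decide), v10])
    (by rw [var3 1 (by decide), var2 1 (by decide), v11])
    (by rw [var3 2 (by decide), var2 2 (by decide), v12])
    (by rw [var3 3 (by decide), var2 3 (by decide), v13]; rfl)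
    (by rw [var3 4 (by decide), var2 4 (by decide), v14]) v37
    (by rw [var3 8 (by decide), var2 8 (by decide), r1.var_eq 8 (by decide)]; simp [load])
    (hb2.congr (arr3 8 (by decide)) (var3 5 (by decide)) (arr3 6 (by decide)))
    (fun i j => by
      rw [arr3 0 (by decide), arr2 0 (by decide), arr1 0 (by decide)]
      simp only [load]
      exact flatten_apply _ i j)
    (fun i j => by
      rw [arr3 5 (by decide), arr2 5 (by decide)]
      exact a15 i j)
    (fun z => by rw [arr3 10 (by decide), arr2 10 (by decide), arr1 10 (by decide)]; simp [load])
    (fun z => by rw [arr3 12 (by decide), arr2 12 (by decide), arr1 12 (by decide)]; simp [load])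
    (fun z => by rw [arr3 14 (by decide), arr2 14 (by decide), arr1 14 (by decide)]; simp [load])
    (fun i j => by
      simp only [adj, Matrix.of_apply]
      split_ifs <;> norm_num)
    (fun i => (x.scaledError_le i).trans (Nat.cast_le.2 (hE _ (by rw [← hS]; omega))))
    hCN hI hH1
  have rr := (r1.mono (mul_cube_le_timeUnit n H c₁)).seq_mul <| r2.seq_mul <| r3.seq_mul <|
    r4.mono (mul_cube_le_timeUnit n H c₄)
  obtain ⟨-, -, t, ht, hle⟩ := rr
  refine ⟨s4, t, ht, hle.trans ?_, fun r c ε hcr hap => ?_⟩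
  -- The exponent 8 is 4 from the powers of `n + 1`, 2 from the number of pivots and 2 from the
  -- length of the integers.
  · have hsize : H.size = 6 * (S + 1) ^ 2 + 1 := Nat.size_pow
    have hn1 : (n + 1) ^ 4 ≤ (S + 1) ^ 4 :=
      Nat.pow_le_pow_left (Nat.succ_le_succ x.n_le_size) 4
    have hone : 1 ≤ (S + 1) ^ 2 := Nat.one_le_pow _ _ (Nat.succ_pos S)
    calc (c₁ + (c₂ + (c₃ + c₄))) * timeUnit n H * (H.size + 1)
        = (c₁ + (c₂ + (c₃ + c₄))) * ((n + 1) ^ 4 * ((2 * H.size + 2) * (H.size + 1))) := by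
          unfold timeUnit
          ring
      _ ≤ (c₁ + (c₂ + (c₃ + c₄))) *
            ((S + 1) ^ 4 * ((16 * (S + 1) ^ 2) * (8 * (S + 1) ^ 2))) := by
          refine Nat.mul_le_mul_left _ (Nat.mul_le_mul hn1 (Nat.mul_le_mul ?_ ?_)) <;>
            rw [hsize] <;> omega
      _ = 128 * (c₁ + (c₂ + (c₃ + c₄))) * (S + 1) ^ 8 := by ring
  -- An empty matrix has rank 0, which contradicts `1 ≤ c * r`.
  · have hn0 : 0 < n := by
      rcases Nat.eq_zero_or_pos n with h0 | h0
      · exfalso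
        have h1 : x.realM.rank ≤ 0 := by
          refine (Matrix.rank_le_card_width _).trans ?_
          simpa using h0.le
        rw [hap.rank_eq] at h1
        rw [Nat.le_zero.1 h1] at hcr
        norm_num at hcr
      · exact h0
    obtain ⟨v, hv, hmax⟩ := hout hn0
    refine isIndepSet_and_indepBound_le (k := v) x.denProd_pos (A := x.adj) (N := x.intM) ?_
      x.intM_cast hCN hCN' hdet2 hI hm1 hm2 hm3 ?_ hmax hcr hap
    · intro i j
      simp only [adj, Matrix.of_apply]
    · intro i
      rw [← hv i]
      simp [output]

end GraphMatrixInput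

theorem lemma2p2 :
    (∀ (n r : ℕ) (c ε : ℝ) (G : SimpleGraph (Fin n)) (M : Matrix (Fin n) (Fin n) ℝ),
      1 ≤ c * r → IsApproxCompletion G M r c ε →
      ∃ T : Finset (Fin n), G.IsIndepSet (T : Set (Fin n)) ∧ indepBound n r c ε ≤ (T.card : ℝ)) ∧
    LogRAM.RandPolyTimeSolvable GraphMatrixInput.size GraphMatrixInput.load
      (fun x => ∃ (r : ℕ) (c ε : ℝ), 1 ≤ c * r ∧ IsApproxCompletion x.G x.realM r c ε)
      (fun x s => x.G.IsIndepSet (x.output s : Set (Fin x.n)) ∧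
        ∀ (r : ℕ) (c ε : ℝ), 1 ≤ c * r → IsApproxCompletion x.G x.realM r c ε →
          indepBound x.n r c ε ≤ ((x.output s).card : ℝ)) := by
  refine ⟨fun n r c ε G M hcr h => exists_indepSet hcr h, ?_⟩
  obtain ⟨c, hc⟩ := GraphMatrixInput.exists_exec_indepProg
  let p : Polynomial ℕ := Polynomial.C c * (Polynomial.X + 1) ^ 8
  have hp : ∀ S, p.eval S = c * (S + 1) ^ 8 := fun S => by simp [p]
  refine ⟨GraphMatrixInput.indepProg, p, fun x => ⟨fun w => ?_, ?_⟩⟩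
  · obtain ⟨s, t, hs, ht, -⟩ := hc x _ w
    exact ⟨s, t, hs, by rwa [hp]⟩
  · rintro ⟨r, c', ε, hcr, hap⟩
    -- Every outcome of the coin flips succeeds, so the probability is 1.
    have huniv : {w : Fin (p.eval x.size) → Bool | ∃ (s : LogRAM.State) (t : ℕ),
        LogRAM.Exec GraphMatrixInput.indepProg (x.load _ w) s t ∧
          (x.G.IsIndepSet (x.output s : Set (Fin x.n)) ∧
            ∀ (r : ℕ) (c ε : ℝ), 1 ≤ c * r → IsApproxCompletion x.G x.realM r c ε →
              indepBound x.n r c ε ≤ ((x.output s).card : ℝ))} = Set.univ := by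
      refine Set.eq_univ_of_forall fun w => ?_
      obtain ⟨s, t, hs, -, hsol⟩ := hc x _ w
      exact ⟨s, t, hs, (hsol r c' ε hcr hap).1, fun r c ε hcr hap => (hsol r c ε hcr hap).2⟩
    rw [huniv, LogRAM.coinProb, Set.ncard_univ, Nat.card_eq_fintype_card]
    simp only [Fintype.card_fun, Fintype.card_bool, Fintype.card_fin, Nat.cast_pow,
      Nat.cast_ofNat]
    rw [div_self (by positivity)]
    norm_num
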